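/- Let $M = L + DS$ with $L \in \mathbb{R}^{f\times N}$, $D \in \mathbb{R}^{f\times d}$ and $0 \ne S \in \mathbb{R}^{d\times N}$. Let $r = \operatorname{rank}(L)$, let $L = U\Sigma V^\top$ be a compact SVD, $P_U = UU^\top$, $P_V = VV^\top$, let $\mathcal{U}$ be the column space of $L$, and let $I = \operatorname{csupp}(S)$ be the set of indices of the nonzero columns of $S$, $s_c = |I|$. Let $\mathcal{P}_I$ be the operator that sets the columns outside $I$ to zero. A pair $(L_0,S_0)$ is in the oracle model $\{M,\mathcal{U},I\}$ if $P_U L_0 = L$, $\mathcal{P}_I(DS_0) = DS$ and $L_0 + DS_0 = L + DS = M$. Assume that $D$ satisfies the generalized frame property with bounds $0<\alpha_\ell \le \alpha_u<\infty$, i.e. $\alpha_\ell\|v\|^2 \le \|Dv\|^2 \le \alpha_u\|v\|^2$ for all $v \in \mathbb{R}^d$. Put $$\mu = \max_{Z \in \mathcal{D}\setminus\{0\}} \frac{\|P_U Z + Z P_V - P_U Z P_V\|_F}{\|Z\|_F},\quad \mathcal{D} = \{DH : \operatorname{csupp}(H) \subseteq I\},$$ $$\beta_U = \max_{\|u\|=1}\frac{\|(I-P_U)Du\|^2}{\|Du\|^2},\quad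 \gamma_V = \max_i \|P_V e_i\|^2,\quad \xi_c = \max_j\|D^\top U V^\top e_j\|,\quad C_c = \frac{\alpha_u}{\alpha_\ell}\frac{\gamma_V\beta_U}{(1-\mu)^2},$$ $$\lambda_c^{\min} = \frac{\xi_c + \sqrt{r s_c\alpha_u}\,\mu\, C_c}{1 - s_c C_c},\qquad \lambda_c^{\max} = \frac{\sqrt{\alpha_\ell}(1-\mu) - \sqrt{r\alpha_u}\,\mu}{\sqrt{s_c}}.$$ Assume $\mu<1$, $s_c\,\alpha_u\gamma_V\beta_U \le \alpha_\ell(1-\mu)^2$ and $s_cC_c \ne 1$ (so that $\lambda_c^{\min}$ is defined). Then for every $\lambda_c \in [\lambda_c^{\min}, \lambda_c^{\max}]$ the problem $$\min_{L',S'} \|L'\|_* + \lambda_c\|S'\|_{1,2}\quad\text{subject to}\quad M = L' + DS',$$ where $\|\cdot\|_*$ is the nuclear norm and $\|\cdot\|_{1,2}$ the sum of the Euclidean norms of the columns, has a solution $(L_0,S_0)$ that is in the oracle model $\{M,\mathcal{U},I\}$, has column space of $L_0$ equal to $\mathcal{U}$, and has $\operatorname{csupp}(S_0) = I$. Moreover,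 every solution has these properties, unless $\mu = 0$ and $\lambda_c = \lambda_c^{\max}$. -/

import Mathlib

open scoped Matrix

noncomputable section

namespace DRPCA

variable {f d N r : ℕ}

/-- The Euclidean norm of a vector. -/
def l2 {k : ℕ} (x : Fin k → ℝ) : ℝ := ‖WithLp.toLp 2 x‖

/-- The Frobenius norm of a matrix. -/
def frobNorm (X : Matrix (Fin f) (Fin N) ℝ) : ℝ := √(∑ i, ∑ j, X i j ^ 2)

/-- The nuclear norm: the sum of the singular values. The singular values of a map out of
`N`-dimensional space vanish from index `N` on. -/
def nuclearNorm (X : Matrix (Fin f) (Fin N) ℝ) : ℝ :=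
  ∑ i ∈ Finset.range N, (Matrix.toEuclideanLin X).singularValues i

/-- The `ℓ_{1,2}` norm: the sum of the Euclidean norms of the columns. -/
def l12Norm (X : Matrix (Fin d) (Fin N) ℝ) : ℝ := ∑ j, l2 (X.col j)

/-- The `(∞,2)` norm: the largest Euclidean norm of a column. -/
def linf2Norm (X : Matrix (Fin d) (Fin N) ℝ) : ℝ := ⨆ j, l2 (X.col j)

/-- The column space of a matrix. -/
def colSpace (X : Matrix (Fin f) (Fin N) ℝ) : Submodule ℝ (Fin f → ℝ) :=
  LinearMap.range X.mulVecLin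

open Classical in
/-- The column support of a matrix: the indices of its nonzero columns. -/
def csupp (X : Matrix (Fin d) (Fin N) ℝ) : Finset (Fin N) :=
  Finset.univ.filter fun j => X.col j ≠ 0

/-- Compact singular value decomposition `L = U Σ Vᵀ` with `Σ = diag(σ)`, where `σ` is positive
and in descending order, and `U`, `V` have orthonormal columns. -/
structure IsCompactSVD (L : Matrix (Fin f) (Fin N) ℝ) (U : Matrix (Fin f) (Fin r) ℝ)
    (σ : Fin r → ℝ) (V : Matrix (Fin N) (Fin r) ℝ) : Prop where
  left_orthonormal : Uᵀ * U = 1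
  right_orthonormal : Vᵀ * V = 1
  pos : ∀ i, 0 < σ i
  antitone : Antitone σ
  eq : L = U * Matrix.diagonal σ * Vᵀ

/-- The matrix of the orthogonal projection onto the column space of `U`, for `U` with orthonormal
columns. -/
def projMat {k : ℕ} (U : Matrix (Fin k) (Fin r) ℝ) : Matrix (Fin k) (Fin k) ℝ := U * Uᵀ

/-- The projection `P_U Z + Z P_V - P_U Z P_V` onto `{U W₁ᵀ + W₂ Vᵀ}`. -/
def projL (U : Matrix (Fin f) (Fin r) ℝ) (V : Matrix (Fin N) (Fin r) ℝ)
    (Z : Matrix (Fin f) (Fin N) ℝ) : Matrix (Fin f) (Fin N) ℝ :=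
  projMat U * Z + Z * projMat V - projMat U * Z * projMat V

/-- The projection onto the matrices whose columns outside `I` vanish. -/
def projCols (I : Finset (Fin N)) (X : Matrix (Fin f) (Fin N) ℝ) : Matrix (Fin f) (Fin N) ℝ :=
  Matrix.of fun i j => if j ∈ I then X i j else 0

/-- The generalized frame property of `D` on the vectors of `R`, with frame bounds `αl`, `αu`. -/
structure GFP (D : Matrix (Fin f) (Fin d) ℝ) (R : Set (Fin d → ℝ)) (αl αu : ℝ) : Prop where
  lower_pos : 0 < αl
  lower_le_upper : αl ≤ αu
  bounds : ∀ v ∈ R, v ≠ 0 → αl * l2 v ^ 2 ≤ l2 (D *ᵥ v) ^ 2 ∧ l2 (D *ᵥ v) ^ 2 ≤ αu * l2 v ^ 2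

/-- The space `{D H : csupp H ⊆ I}`. -/
def dictSpace (D : Matrix (Fin f) (Fin d) ℝ) (I : Finset (Fin N)) :
    Set (Matrix (Fin f) (Fin N) ℝ) :=
  {Z | ∃ H : Matrix (Fin d) (Fin N) ℝ, csupp H ⊆ I ∧ Z = D * H}

/-- The incoherence `μ` between the low-rank part and the dictionary-sparse part. -/
def mu (D : Matrix (Fin f) (Fin d) ℝ) (I : Finset (Fin N))
    (U : Matrix (Fin f) (Fin r) ℝ) (V : Matrix (Fin N) (Fin r) ℝ) : ℝ :=
  sSup ((fun Z => frobNorm (projL U V Z) / frobNorm Z) '' (dictSpace D I \ {0}))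

/-- The parameter `β_U = max_{‖u‖ = 1} ‖(I - P_U) D u‖² / ‖D u‖²`. -/
def betaU (D : Matrix (Fin f) (Fin d) ℝ) (U : Matrix (Fin f) (Fin r) ℝ) : ℝ :=
  sSup ((fun u => l2 ((1 - projMat U) *ᵥ (D *ᵥ u)) ^ 2 / l2 (D *ᵥ u) ^ 2) ''
    {u : Fin d → ℝ | l2 u = 1})

/-- The parameter `γ_V = max_i ‖P_V e_i‖²`. -/
def gammaV (V : Matrix (Fin N) (Fin r) ℝ) : ℝ :=
  ⨆ i : Fin N, l2 (projMat V *ᵥ Pi.single i 1) ^ 2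

/-- The parameter `ξ_c = ‖Dᵀ U Vᵀ‖_{∞,2}`. -/
def xiC (D : Matrix (Fin f) (Fin d) ℝ) (U : Matrix (Fin f) (Fin r) ℝ)
    (V : Matrix (Fin N) (Fin r) ℝ) : ℝ :=
  linf2Norm (Dᵀ * U * Vᵀ)

/-- The constant `C_c = (α_u / α_ℓ) (1 - μ)⁻² γ_V β_U`. -/
def constC (αl αu μ γV βU : ℝ) : ℝ := αu / αl * (1 / (1 - μ) ^ 2) * γV * βU

/-- The lower end `λ_c^min` of the range of regularization parameters, `C` being `C_c`. -/
def lamMin (αu μ ξ C : ℝ) (r s : ℕ) : ℝ := (ξ + √(r * s * αu) * μ * C) / (1 - s * C)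

/-- The upper end `λ_c^max` of the range of regularization parameters. -/
def lamMax (αl αu μ : ℝ) (r s : ℕ) : ℝ := (√αl * (1 - μ) - √(r * αu) * μ) / √s

/-- Membership of `(L₀, S₀)` in the oracle model defined by `(L, S)`, where the columns of `U` are
an orthonormal basis of the column space of `L`. -/
structure InOracleModel (D : Matrix (Fin f) (Fin d) ℝ) (L : Matrix (Fin f) (Fin N) ℝ)
    (S : Matrix (Fin d) (Fin N) ℝ) (U : Matrix (Fin f) (Fin r) ℝ)
    (L₀ : Matrix (Fin f) (Fin N) ℝ) (S₀ : Matrix (Fin d) (Fin N) ℝ) : Prop where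
  proj_colSpace : projMat U * L₀ = L
  proj_csupp : projCols (csupp S) (D * S₀) = D * S
  sum_eq : L₀ + D * S₀ = L + D * S

/-- `(L₀, S₀)` solves: minimize `‖L'‖_* + lam * ‖S'‖_{1,2}` subject to `M = L' + D S'`. -/
structure IsSolution (M : Matrix (Fin f) (Fin N) ℝ) (D : Matrix (Fin f) (Fin d) ℝ) (lam : ℝ)
    (L₀ : Matrix (Fin f) (Fin N) ℝ) (S₀ : Matrix (Fin d) (Fin N) ℝ) : Prop where
  feasible : M = L₀ + D * S₀
  le : ∀ (L' : Matrix (Fin f) (Fin N) ℝ) (S' : Matrix (Fin d) (Fin N) ℝ), M = L' + D * S' →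
    nuclearNorm L₀ + lam * l12Norm S₀ ≤ nuclearNorm L' + lam * l12Norm S'

end DRPCA

end

open scoped Matrix

noncomputable section

namespace DRPCA

/-! The pair `(L, S)` itself is a solution, and under the strictness condition it is the only one.
Optimality is certified by a matrix `Q = U * Vᵀ + Γ`. If `Q` is a contraction that attains the
nuclear norm of `L`, and the columns of `Dᵀ * Q` are subgradients of `lam * l2` at the columns of
`S`, then pairing `Q` with `M` bounds the objective at every feasible pair from below by its value
at `(L, S)`.

`Γ` is the projection of some `D * G`, with `G` supported on `I = csupp S`, onto the orthogonal
complement of `{U W₁ᵀ + W₂ Vᵀ}`. Prescribing the columns of `Dᵀ * Q` on `I` is a square linear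
system for `G`, solvable because `μ < 1` keeps `D * G` away from `{U W₁ᵀ + W₂ Vᵀ}`
(`frobNorm_projPerp_ge`, `exists_projPerp_mul_eq`). The upper bound on `lam` gives `frobNorm Γ ≤ 1`,
so `Q` is a contraction; the lower bound controls the columns of `Dᵀ * Q` off `I`
(`l2_col_projPerp_le`). All this meets in `exists_isDualCertificate`.

If `frobNorm Γ < 1`, any solution `(L₀, S₀)` saturates both duality bounds. This puts the columns of
`L₀`, hence of `D * (S₀ - S)`, in the column space of `U`, and kills the columns of `S₀ - S` off `I`
when `lam > ξ`. As `μ < 1`, no nonzero `D * H` with `H` supported on `I` has its columns in that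
space, so `S₀ = S`. The case `lam ≤ ξ` is degenerate and is settled in `eq_zero_of_projMat_mul_eq`.
-/

/-! ### Euclidean norm of vectors. -/

lemma l2_nonneg {k : ℕ} (x : Fin k → ℝ) : 0 ≤ l2 x := norm_nonneg _

lemma l2_sq {k : ℕ} (x : Fin k → ℝ) : l2 x ^ 2 = x ⬝ᵥ x := by
  simp [l2, EuclideanSpace.norm_sq_eq, dotProduct, ← sq]

lemma l2_mul_self {k : ℕ} (x : Fin k → ℝ) : l2 x * l2 x = x ⬝ᵥ x := by
  rw [← sq, l2_sq]

@[simp] lemma l2_zero {k : ℕ} : l2 (0 : Fin k → ℝ) = 0 := by simp [l2]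

lemma l2_eq_zero {k : ℕ} {x : Fin k → ℝ} : l2 x = 0 ↔ x = 0 := by simp [l2]

lemma l2_pos {k : ℕ} {x : Fin k → ℝ} (hx : x ≠ 0) : 0 < l2 x :=
  (l2_nonneg x).lt_of_ne fun h => hx (l2_eq_zero.1 h.symm)

lemma l2_smul {k : ℕ} (c : ℝ) (x : Fin k → ℝ) : l2 (c • x) = |c| * l2 x := by
  simp [l2, norm_smul]

lemma l2_add_le {k : ℕ} (x y : Fin k → ℝ) : l2 (x + y) ≤ l2 x + l2 y := by
  simpa [l2] using norm_add_le (WithLp.toLp 2 x) (WithLp.toLp 2 y)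

lemma l2_sum_le {k : ℕ} {ι : Type*} (t : Finset ι) (x : ι → Fin k → ℝ) :
    l2 (∑ i ∈ t, x i) ≤ ∑ i ∈ t, l2 (x i) := by
  classical
  induction t using Finset.induction_on with
  | empty => simp
  | insert a t ha ih =>
    rw [Finset.sum_insert ha, Finset.sum_insert ha]
    exact (l2_add_le _ _).trans (by gcongr)

lemma dotProduct_le_l2 {k : ℕ} (x y : Fin k → ℝ) : x ⬝ᵥ y ≤ l2 x * l2 y := by
  have h := real_inner_le_norm (WithLp.toLp 2 x : EuclideanSpace ℝ (Fin k)) (WithLp.toLp 2 y)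
  simpa [l2, EuclideanSpace.inner_eq_star_dotProduct, dotProduct_comm] using h

lemma l2_le_of_dotProduct_le {k : ℕ} {x : Fin k → ℝ} {c : ℝ} (h : x ⬝ᵥ x ≤ c * l2 x) (hc : 0 ≤ c) :
    l2 x ≤ c := by
  rcases (l2_nonneg x).eq_or_lt with h0 | h0
  · rwa [← h0]
  · rw [← l2_mul_self] at h
    exact le_of_mul_le_mul_right h h0

/-! ### Frobenius inner product and norm. -/

/-- The Frobenius inner product of two matrices. -/
def frobInner {m n : ℕ} (X Y : Matrix (Fin m) (Fin n) ℝ) : ℝ := ∑ i, ∑ j, X i j * Y i j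

section frobInner

variable {k m n : ℕ}

lemma frobInner_eq_sum_row (X Y : Matrix (Fin m) (Fin n) ℝ) :
    frobInner X Y = ∑ i, X i ⬝ᵥ Y i := rfl

lemma frobInner_eq_sum_col (X Y : Matrix (Fin m) (Fin n) ℝ) :
    frobInner X Y = ∑ j, X.col j ⬝ᵥ Y.col j := by
  rw [frobInner, Finset.sum_comm]; rfl

lemma frobInner_eq_trace (X Y : Matrix (Fin m) (Fin n) ℝ) :
    frobInner X Y = (Xᵀ * Y).trace := by
  rw [frobInner_eq_sum_col]; rfl

lemma frobInner_comm (X Y : Matrix (Fin m) (Fin n) ℝ) : frobInner X Y = frobInner Y X := by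
  simp only [frobInner, mul_comm]

lemma frobInner_add_left (X Y Z : Matrix (Fin m) (Fin n) ℝ) :
    frobInner (X + Y) Z = frobInner X Z + frobInner Y Z := by
  simp [frobInner, add_mul, Finset.sum_add_distrib]

lemma frobInner_add_right (X Y Z : Matrix (Fin m) (Fin n) ℝ) :
    frobInner X (Y + Z) = frobInner X Y + frobInner X Z := by
  simp [frobInner, mul_add, Finset.sum_add_distrib]

lemma frobInner_sub_right (X Y Z : Matrix (Fin m) (Fin n) ℝ) :
    frobInner X (Y - Z) = frobInner X Y - frobInner X Z := by
  simp [frobInner, mul_sub, Finset.sum_sub_distrib]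

@[simp] lemma frobInner_zero_left (X : Matrix (Fin m) (Fin n) ℝ) : frobInner 0 X = 0 := by
  simp [frobInner]

lemma frobInner_mul_left (A : Matrix (Fin k) (Fin m) ℝ) (X : Matrix (Fin m) (Fin n) ℝ)
    (Y : Matrix (Fin k) (Fin n) ℝ) : frobInner (A * X) Y = frobInner X (Aᵀ * Y) := by
  simp [frobInner_eq_trace, Matrix.transpose_mul, Matrix.mul_assoc]

lemma frobInner_mul_right (X : Matrix (Fin k) (Fin m) ℝ) (A : Matrix (Fin m) (Fin n) ℝ)
    (Y : Matrix (Fin k) (Fin n) ℝ) : frobInner (X * A) Y = frobInner X (Y * Aᵀ) := by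
  rw [frobInner_eq_trace, frobInner_eq_trace, Matrix.transpose_mul, Matrix.mul_assoc,
    Matrix.trace_mul_comm, Matrix.mul_assoc]

lemma frobNorm_nonneg (X : Matrix (Fin m) (Fin n) ℝ) : 0 ≤ frobNorm X := Real.sqrt_nonneg _

lemma frobNorm_sq (X : Matrix (Fin m) (Fin n) ℝ) : frobNorm X ^ 2 = frobInner X X := by
  rw [frobNorm, Real.sq_sqrt (by positivity)]
  simp [frobInner, sq]

lemma frobNorm_sq_eq_sum_row (X : Matrix (Fin m) (Fin n) ℝ) :
    frobNorm X ^ 2 = ∑ i, l2 (X i) ^ 2 := by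
  simp_rw [frobNorm_sq, l2_sq, frobInner_eq_sum_row]

lemma frobNorm_sq_eq_sum_col (X : Matrix (Fin m) (Fin n) ℝ) :
    frobNorm X ^ 2 = ∑ j, l2 (X.col j) ^ 2 := by
  simp_rw [frobNorm_sq, l2_sq, frobInner_eq_sum_col]

@[simp] lemma frobNorm_zero : frobNorm (0 : Matrix (Fin m) (Fin n) ℝ) = 0 := by simp [frobNorm]

lemma frobNorm_eq_zero {X : Matrix (Fin m) (Fin n) ℝ} : frobNorm X = 0 ↔ X = 0 := by
  refine ⟨fun h => ?_, fun h => by simp [h]⟩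
  have h2 := frobNorm_sq_eq_sum_row X
  rw [h, eq_comm, zero_pow two_ne_zero,
    Finset.sum_eq_zero_iff_of_nonneg fun i _ => sq_nonneg _] at h2
  funext i
  exact l2_eq_zero.1 (pow_eq_zero_iff two_ne_zero |>.1 (h2 i (Finset.mem_univ i)))

lemma frobNorm_pos {X : Matrix (Fin m) (Fin n) ℝ} (hX : X ≠ 0) : 0 < frobNorm X :=
  (frobNorm_nonneg X).lt_of_ne fun h => hX (frobNorm_eq_zero.1 h.symm)

lemma frobInner_le (X Y : Matrix (Fin m) (Fin n) ℝ) :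
    frobInner X Y ≤ frobNorm X * frobNorm Y := by
  have h := Real.sum_mul_le_sqrt_mul_sqrt (Finset.univ : Finset (Fin m × Fin n))
    (fun p => X p.1 p.2) (fun p => Y p.1 p.2)
  simpa [frobInner, frobNorm, Fintype.sum_prod_type] using h

/-- The operator norm is at most the Frobenius norm; this lets the certificate be controlled in
Frobenius norm alone. -/
lemma l2_mulVec_le (X : Matrix (Fin m) (Fin n) ℝ) (v : Fin n → ℝ) :
    l2 (X *ᵥ v) ≤ frobNorm X * l2 v := by
  refine le_of_sq_le_sq ?_ (mul_nonneg (frobNorm_nonneg _) (l2_nonneg _))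
  rw [mul_pow, frobNorm_sq_eq_sum_row, Finset.sum_mul, l2_sq]
  refine Finset.sum_le_sum fun i _ => ?_
  have h1 : X i ⬝ᵥ v ≤ l2 (X i) * l2 v := dotProduct_le_l2 _ _
  have h2 : -(X i ⬝ᵥ v) ≤ l2 (X i) * l2 v := by
    have := dotProduct_le_l2 (-X i) v
    rwa [neg_dotProduct, show l2 (-X i) = l2 (X i) by simp [l2]] at this
  have h3 : (X i ⬝ᵥ v) ^ 2 ≤ (l2 (X i) * l2 v) ^ 2 := sq_le_sq' (by linarith) h1
  calc _ = (X i ⬝ᵥ v) ^ 2 := (sq _).symm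
    _ ≤ _ := h3
    _ = _ := mul_pow _ _ _

lemma col_mul (A : Matrix (Fin k) (Fin m) ℝ) (X : Matrix (Fin m) (Fin n) ℝ) (j : Fin n) :
    (A * X).col j = A *ᵥ X.col j := rfl

end frobInner

/-! ### Nuclear norm and its duality with contractions. -/

/-- An orthonormal basis of right singular vectors. -/
lemma exists_singular_basis {m n : ℕ} (X : Matrix (Fin m) (Fin n) ℝ) :
    ∃ W : Matrix (Fin n) (Fin n) ℝ, Wᵀ * W = 1 ∧
      (∀ i, Xᵀ *ᵥ (X *ᵥ W.col i) = l2 (X *ᵥ W.col i) ^ 2 • W.col i) ∧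
      nuclearNorm X = ∑ i, l2 (X *ᵥ W.col i) := by
  set T := Matrix.toEuclideanLin X with hT
  have hn : Module.finrank ℝ (EuclideanSpace ℝ (Fin n)) = n := by simp
  let b := T.isSymmetric_adjoint_comp_self.eigenvectorBasis hn
  have hb (i : Fin n) : (LinearMap.adjoint T ∘ₗ T) (b i) = T.singularValues i ^ 2 • b i := by
    rw [T.sq_singularValues_fin hn]
    exact T.isSymmetric_adjoint_comp_self.apply_eigenvectorBasis hn i
  have hnorm (i : Fin n) : ‖T (b i)‖ = T.singularValues i := by
    refine (sq_eq_sq₀ (norm_nonneg _) (T.singularValues_nonneg i)).1 ?_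
    rw [← real_inner_self_eq_norm_sq, ← LinearMap.adjoint_inner_right]
    have := hb i
    rw [LinearMap.comp_apply] at this
    rw [this, inner_smul_right, real_inner_self_eq_norm_sq, b.norm_eq_one]
    simp
  refine ⟨Matrix.of fun i j => b j i, ?_, ?_, ?_⟩
  · ext i j
    have := orthonormal_iff_ite.1 b.orthonormal i j
    rw [EuclideanSpace.inner_eq_star_dotProduct] at this
    rw [Matrix.one_apply, ← this, dotProduct_comm]
    rfl
  · intro i
    have h := congrArg WithLp.ofLp (hb i)
    rw [LinearMap.comp_apply, ← hnorm i, hT, ← Matrix.toEuclideanLin_conjTranspose_eq_adjoint] at h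
    rw [Matrix.conjTranspose_eq_transpose_of_trivial] at h
    exact h
  · rw [nuclearNorm, ← Fin.sum_univ_eq_sum_range (fun i => T.singularValues i) n]
    exact Finset.sum_congr rfl fun i _ => (hnorm i).symm

lemma frobInner_eq_sum_basis {m n : ℕ} {W : Matrix (Fin n) (Fin n) ℝ} (hW : Wᵀ * W = 1)
    (X Y : Matrix (Fin m) (Fin n) ℝ) :
    frobInner X Y = ∑ i, (X *ᵥ W.col i) ⬝ᵥ (Y *ᵥ W.col i) := by
  have h := frobInner_eq_sum_col (X * W) (Y * W)
  rwa [frobInner_mul_right, Matrix.mul_assoc, mul_eq_one_comm.1 hW, Matrix.mul_one] at h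

lemma l2_basis_col {n : ℕ} {W : Matrix (Fin n) (Fin n) ℝ} (hW : Wᵀ * W = 1) (i : Fin n) :
    l2 (W.col i) = 1 := by
  have h : W.col i ⬝ᵥ W.col i = 1 := by
    have := congrFun (congrFun hW i) i
    rwa [Matrix.one_apply_eq] at this
  rw [← l2_mul_self] at h
  nlinarith [l2_nonneg (W.col i)]

/-- Evaluated in a right singular basis of `X`, each term of the inner product is at most `l2 (X *ᵥ
W.col i)` by Cauchy–Schwarz. -/
lemma frobInner_le_nuclearNorm {m n : ℕ} {Q : Matrix (Fin m) (Fin n) ℝ}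
    (hQ : ∀ v, l2 (Q *ᵥ v) ≤ l2 v) (X : Matrix (Fin m) (Fin n) ℝ) :
    frobInner Q X ≤ nuclearNorm X := by
  obtain ⟨W, hW, -, hX⟩ := exists_singular_basis X
  rw [hX, frobInner_eq_sum_basis hW]
  refine Finset.sum_le_sum fun i _ => (dotProduct_le_l2 _ _).trans ?_
  exact mul_le_of_le_one_left (l2_nonneg _) ((hQ _).trans (l2_basis_col hW i).le)

/-- If the contraction `Q` attains the nuclear norm of `X`, then the range of `X` is contained in
every subspace into which `Q` maps all the vectors whose norm it preserves. -/
lemma mulVec_mem_of_frobInner_eq {m n : ℕ} {Q X : Matrix (Fin m) (Fin n) ℝ}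
    (hQ : ∀ v, l2 (Q *ᵥ v) ≤ l2 v) (h : frobInner Q X = nuclearNorm X)
    (K : Submodule ℝ (Fin m → ℝ)) (hK : ∀ v, l2 (Q *ᵥ v) = l2 v → Q *ᵥ v ∈ K) (v : Fin n → ℝ) :
    X *ᵥ v ∈ K := by
  obtain ⟨W, hW, -, hX⟩ := exists_singular_basis X
  have key (i) : (Q *ᵥ W.col i) ⬝ᵥ (X *ᵥ W.col i) = l2 (X *ᵥ W.col i) := by
    refine (Finset.sum_eq_sum_iff_of_le (fun i _ => (dotProduct_le_l2 _ _).trans ?_)).1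
      ((frobInner_eq_sum_basis hW Q X).symm.trans (h.trans hX)) i (Finset.mem_univ i)
    exact mul_le_of_le_one_left (l2_nonneg _) ((hQ _).trans (l2_basis_col hW i).le)
  have mem (i) : X *ᵥ W.col i ∈ K := by
    set q := Q *ᵥ W.col i with hq
    set x := X *ᵥ W.col i with hx
    by_cases h0 : x = 0
    · rw [h0]; exact K.zero_mem
    have h1 : l2 q ≤ 1 := (hQ _).trans (l2_basis_col hW i).le
    have hxpos := l2_pos h0
    have h2 : l2 q = 1 := by
      refine le_antisymm h1 (le_of_mul_le_mul_right ?_ hxpos)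
      rw [one_mul]
      exact (key i).symm.le.trans (dotProduct_le_l2 _ _)
    -- Equality in Cauchy–Schwarz with `l2 q = 1`: `x` is a nonnegative multiple of `q`.
    have h3 : x = l2 x • q := by
      refine sub_eq_zero.1 (l2_eq_zero.1 (pow_eq_zero_iff two_ne_zero |>.1 ?_))
      have hqx : x ⬝ᵥ q = l2 x := (dotProduct_comm _ _).trans (key i)
      rw [l2_sq, sub_dotProduct, dotProduct_sub, dotProduct_sub]
      simp only [dotProduct_smul, smul_dotProduct, smul_eq_mul]
      rw [hqx, key i, ← l2_mul_self, ← l2_mul_self, h2]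
      ring
    rw [h3]
    exact K.smul_mem _ (hK _ (h2.trans (l2_basis_col hW i).symm))
  have hv : v = ∑ i, (Wᵀ *ᵥ v) i • W.col i := by
    have : W *ᵥ (Wᵀ *ᵥ v) = v := by
      rw [Matrix.mulVec_mulVec, mul_eq_one_comm.1 hW, Matrix.one_mulVec]
    conv_lhs => rw [← this, Matrix.mulVec_eq_sum]
    simp [Matrix.col]
  rw [hv, Matrix.mulVec_sum]
  exact K.sum_mem fun i _ => by
    rw [Matrix.mulVec_smul]
    exact K.smul_mem _ (mem i)

variable {f d N r : ℕ}

lemma dotProduct_mulVec_left {m n : ℕ} (A : Matrix (Fin m) (Fin n) ℝ) (x : Fin n → ℝ)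
    (y : Fin m → ℝ) : (A *ᵥ x) ⬝ᵥ y = x ⬝ᵥ (Aᵀ *ᵥ y) := by
  rw [dotProduct_comm, Matrix.dotProduct_mulVec, ← Matrix.mulVec_transpose, dotProduct_comm]

/-- For `s > 0` the vector `P *ᵥ w - s • w` would be an eigenvector of `P` for `-s`, which
positivity excludes unless it vanishes. -/
lemma eq_smul_of_mulVec_mulVec_eq {n : ℕ} {P : Matrix (Fin n) (Fin n) ℝ} (hP : Pᵀ = P)
    (hpos : ∀ x, 0 ≤ x ⬝ᵥ (P *ᵥ x)) {s : ℝ} (hs : 0 ≤ s) {w : Fin n → ℝ}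
    (hw : P *ᵥ (P *ᵥ w) = s ^ 2 • w) : P *ᵥ w = s • w := by
  rcases hs.eq_or_lt with rfl | hs
  · rw [zero_smul, ← l2_eq_zero, ← pow_eq_zero_iff two_ne_zero, l2_sq, dotProduct_mulVec_left, hP,
      hw]
    simp
  · have h1 : P *ᵥ (P *ᵥ w - s • w) = -s • (P *ᵥ w - s • w) := by
      rw [Matrix.mulVec_sub, hw, Matrix.mulVec_smul, smul_sub, smul_smul]
      module
    have h2 := hpos (P *ᵥ w - s • w)
    rw [h1, dotProduct_smul, ← l2_sq, smul_eq_mul] at h2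
    refine sub_eq_zero.1 (l2_eq_zero.1 (pow_eq_zero_iff two_ne_zero |>.1 ?_))
    nlinarith [sq_nonneg (l2 (P *ᵥ w - s • w))]

/-- `P = V Σ Vᵀ` is the positive square root of `Lᵀ * L`, so the right singular vectors of `L` are
eigenvectors of `P` with the singular values as eigenvalues. Since `(U * Vᵀ)ᵀ * L = P`, the identity
holds term by term in that basis. -/
lemma IsCompactSVD.nuclearNorm_eq {L : Matrix (Fin f) (Fin N) ℝ} {U : Matrix (Fin f) (Fin r) ℝ}
    {σ : Fin r → ℝ} {V : Matrix (Fin N) (Fin r) ℝ} (h : IsCompactSVD L U σ V) :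
    nuclearNorm L = frobInner (U * Vᵀ) L := by
  obtain ⟨W, hW, hWL, hL⟩ := exists_singular_basis L
  rw [hL, frobInner_eq_sum_basis hW]
  refine Finset.sum_congr rfl fun i _ => ?_
  set P : Matrix (Fin N) (Fin N) ℝ := V * Matrix.diagonal σ * Vᵀ with hPdef
  have hP : Pᵀ = P := by
    simp [hPdef, Matrix.transpose_mul, Matrix.mul_assoc]
  have hpos (x : Fin N → ℝ) : 0 ≤ x ⬝ᵥ (P *ᵥ x) := by
    have : x ⬝ᵥ (P *ᵥ x) = ∑ k, (Vᵀ *ᵥ x) k * (σ k * (Vᵀ *ᵥ x) k) := by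
      rw [hPdef, Matrix.mul_assoc, ← Matrix.mulVec_mulVec, ← Matrix.mulVec_mulVec,
        ← Matrix.transpose_transpose V, ← dotProduct_mulVec_left, Matrix.transpose_transpose]
      simp [dotProduct, Matrix.mulVec_diagonal]
    rw [this]
    refine Finset.sum_nonneg fun k _ => ?_
    nlinarith [mul_nonneg (h.pos k).le (sq_nonneg ((Vᵀ *ᵥ x) k))]
  have hLL : Lᵀ * L = P * P := by
    have h1 : Lᵀ * L = V * Matrix.diagonal σ * (Uᵀ * U) * (Matrix.diagonal σ * Vᵀ) := by
      rw [h.eq]; simp [Matrix.transpose_mul, Matrix.mul_assoc]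
    have h2 : P * P = V * Matrix.diagonal σ * (Vᵀ * V) * (Matrix.diagonal σ * Vᵀ) := by
      simp only [hPdef, Matrix.mul_assoc]
    rw [h1, h2, h.left_orthonormal, h.right_orthonormal]
  have hPw : P *ᵥ W.col i = l2 (L *ᵥ W.col i) • W.col i := by
    refine eq_smul_of_mulVec_mulVec_eq hP hpos (l2_nonneg _) ?_
    rw [Matrix.mulVec_mulVec, ← hLL, ← Matrix.mulVec_mulVec, hWL i]
  have hUL : (U * Vᵀ)ᵀ * L = P := by
    have h1 : (U * Vᵀ)ᵀ * L = V * (Uᵀ * U) * (Matrix.diagonal σ * Vᵀ) := by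
      rw [h.eq]; simp [Matrix.transpose_mul, Matrix.mul_assoc]
    rw [h1, h.left_orthonormal, Matrix.mul_one, hPdef, Matrix.mul_assoc]
  rw [dotProduct_mulVec_left, Matrix.mulVec_mulVec, hUL, hPw, dotProduct_smul, ← l2_sq,
    l2_basis_col hW]
  simp

/-! ### Projections onto `{U W₁ᵀ + W₂ Vᵀ}` and its complement. -/

section projections

lemma projMat_transpose {k : ℕ} (U : Matrix (Fin k) (Fin r) ℝ) : (projMat U)ᵀ = projMat U := by
  simp [projMat, Matrix.transpose_mul]

lemma projMat_mul_self {k : ℕ} {U : Matrix (Fin k) (Fin r) ℝ} (hU : Uᵀ * U = 1) :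
    projMat U * projMat U = projMat U := by
  rw [projMat, Matrix.mul_assoc, ← Matrix.mul_assoc Uᵀ, hU, Matrix.one_mul]

lemma projMat_mul {k : ℕ} {U : Matrix (Fin k) (Fin r) ℝ} (hU : Uᵀ * U = 1) :
    projMat U * U = U := by
  rw [projMat, Matrix.mul_assoc, hU, Matrix.mul_one]

lemma transpose_mul_projMat {k : ℕ} {U : Matrix (Fin k) (Fin r) ℝ} (hU : Uᵀ * U = 1) :
    Uᵀ * projMat U = Uᵀ := by
  rw [projMat, ← Matrix.mul_assoc, hU, Matrix.one_mul]

lemma one_sub_projMat_transpose {k : ℕ} (U : Matrix (Fin k) (Fin r) ℝ) :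
    (1 - projMat U)ᵀ = 1 - projMat U := by
  simp [projMat_transpose]

lemma one_sub_projMat_mul_self {k : ℕ} {U : Matrix (Fin k) (Fin r) ℝ} (hU : Uᵀ * U = 1) :
    (1 - projMat U) * (1 - projMat U) = 1 - projMat U := by
  simp [sub_mul, mul_sub, projMat_mul_self hU]

lemma l2_sq_eq_projMat_add {k : ℕ} {U : Matrix (Fin k) (Fin r) ℝ} (hU : Uᵀ * U = 1)
    (x : Fin k → ℝ) :
    l2 x ^ 2 = l2 (projMat U *ᵥ x) ^ 2 + l2 ((1 - projMat U) *ᵥ x) ^ 2 := by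
  simp only [l2_sq]
  rw [dotProduct_mulVec_left, dotProduct_mulVec_left, Matrix.mulVec_mulVec, Matrix.mulVec_mulVec,
    one_sub_projMat_transpose, projMat_transpose, projMat_mul_self hU, one_sub_projMat_mul_self hU,
    ← dotProduct_add, ← Matrix.add_mulVec]
  simp

lemma l2_one_sub_projMat_le {k : ℕ} {U : Matrix (Fin k) (Fin r) ℝ} (hU : Uᵀ * U = 1)
    (x : Fin k → ℝ) : l2 ((1 - projMat U) *ᵥ x) ≤ l2 x := by
  refine le_of_sq_le_sq ?_ (l2_nonneg _)
  rw [l2_sq_eq_projMat_add hU x]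
  nlinarith [sq_nonneg (l2 (projMat U *ᵥ x))]

/-- The projection onto the orthogonal complement of `{U W₁ᵀ + W₂ Vᵀ}`. -/
def projPerp (U : Matrix (Fin f) (Fin r) ℝ) (V : Matrix (Fin N) (Fin r) ℝ)
    (Z : Matrix (Fin f) (Fin N) ℝ) : Matrix (Fin f) (Fin N) ℝ :=
  (1 - projMat U) * Z * (1 - projMat V)

variable {U : Matrix (Fin f) (Fin r) ℝ} {V : Matrix (Fin N) (Fin r) ℝ}

lemma projL_add_projPerp (U : Matrix (Fin f) (Fin r) ℝ) (V : Matrix (Fin N) (Fin r) ℝ)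
    (Z : Matrix (Fin f) (Fin N) ℝ) : projL U V Z + projPerp U V Z = Z := by
  simp only [projL, projPerp, Matrix.sub_mul, Matrix.mul_sub, Matrix.one_mul, Matrix.mul_one]
  abel

lemma frobInner_projPerp_left (X Y : Matrix (Fin f) (Fin N) ℝ) :
    frobInner (projPerp U V X) Y = frobInner X (projPerp U V Y) := by
  rw [projPerp, Matrix.mul_assoc, frobInner_mul_left, frobInner_mul_right,
    one_sub_projMat_transpose, one_sub_projMat_transpose]
  rfl

lemma projPerp_projPerp (hU : Uᵀ * U = 1) (hV : Vᵀ * V = 1) (Z : Matrix (Fin f) (Fin N) ℝ) :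
    projPerp U V (projPerp U V Z) = projPerp U V Z := by
  have : projPerp U V (projPerp U V Z) = ((1 - projMat U) * (1 - projMat U)) * Z *
      ((1 - projMat V) * (1 - projMat V)) := by
    simp only [projPerp, Matrix.mul_assoc]
  rw [this, one_sub_projMat_mul_self hU, one_sub_projMat_mul_self hV]
  rfl

lemma frobNorm_projPerp_sq (hU : Uᵀ * U = 1) (hV : Vᵀ * V = 1) (Z : Matrix (Fin f) (Fin N) ℝ) :
    frobNorm (projPerp U V Z) ^ 2 = frobInner Z (projPerp U V Z) := by
  rw [frobNorm_sq, frobInner_projPerp_left, projPerp_projPerp hU hV]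

lemma frobNorm_sq_eq_projL_add (hU : Uᵀ * U = 1) (hV : Vᵀ * V = 1)
    (Z : Matrix (Fin f) (Fin N) ℝ) :
    frobNorm Z ^ 2 = frobNorm (projL U V Z) ^ 2 + frobNorm (projPerp U V Z) ^ 2 := by
  have h1 : projL U V Z = Z - projPerp U V Z := eq_sub_of_add_eq (projL_add_projPerp U V Z)
  have h2 := frobNorm_projPerp_sq hU hV Z
  rw [frobNorm_sq (projL U V Z), h1, frobInner_sub_right, frobInner_comm _ Z,
    frobInner_comm _ (projPerp U V Z), frobInner_sub_right, frobInner_sub_right,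
    frobInner_comm (projPerp U V Z) Z, ← h2, ← frobNorm_sq, ← frobNorm_sq]
  ring

lemma frobNorm_projL_le (hU : Uᵀ * U = 1) (hV : Vᵀ * V = 1) (Z : Matrix (Fin f) (Fin N) ℝ) :
    frobNorm (projL U V Z) ≤ frobNorm Z := by
  refine le_of_sq_le_sq ?_ (frobNorm_nonneg _)
  rw [frobNorm_sq_eq_projL_add hU hV Z]
  nlinarith [sq_nonneg (frobNorm (projPerp U V Z))]

lemma projL_eq_self {Z : Matrix (Fin f) (Fin N) ℝ} (h : projMat U * Z = Z) :
    projL U V Z = Z := by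
  simp [projL, h]

lemma frobInner_mul_transpose_projL (hU : Uᵀ * U = 1) (Z : Matrix (Fin f) (Fin N) ℝ) :
    frobInner (U * Vᵀ) Z = frobInner (U * Vᵀ) (projL U V Z) := by
  have h0 : projPerp U V (U * Vᵀ) = 0 := by
    rw [projPerp, ← Matrix.mul_assoc, Matrix.sub_mul, projMat_mul hU]
    simp
  conv_lhs => rw [← projL_add_projPerp U V Z, frobInner_add_right, ← frobInner_projPerp_left, h0]
  simp

lemma frobNorm_mul_transpose (hU : Uᵀ * U = 1) (hV : Vᵀ * V = 1) :
    frobNorm (U * Vᵀ) = √r := by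
  rw [eq_comm, Real.sqrt_eq_iff_eq_sq (by positivity) (frobNorm_nonneg _), frobNorm_sq,
    frobInner_mul_left, ← Matrix.mul_assoc, hU, Matrix.one_mul, frobInner_eq_trace,
    Matrix.transpose_transpose, Matrix.trace_mul_comm, hV]
  simp

end projections

lemma l2_neg {k : ℕ} (x : Fin k → ℝ) : l2 (-x) = l2 x := by simp [l2]

lemma frobNorm_neg {m n : ℕ} (X : Matrix (Fin m) (Fin n) ℝ) : frobNorm (-X) = frobNorm X := by
  simp [frobNorm]

lemma frobInner_neg_right {m n : ℕ} (X Y : Matrix (Fin m) (Fin n) ℝ) :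
    frobInner X (-Y) = -frobInner X Y := by
  simp [frobInner]

lemma neg_frobInner_le {m n : ℕ} (X Y : Matrix (Fin m) (Fin n) ℝ) :
    -frobInner X Y ≤ frobNorm X * frobNorm Y := by
  rw [← frobInner_neg_right, ← frobNorm_neg Y]
  exact frobInner_le _ _

lemma l2_col_eq_zero_of_notMem {X : Matrix (Fin d) (Fin N) ℝ} {I : Finset (Fin N)}
    (h : csupp X ⊆ I) {j : Fin N} (hj : j ∉ I) : X.col j = 0 := by
  by_contra h0
  exact hj (h (by simp [csupp, h0]))

/-! ### Consequences of the frame bounds. -/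

section frame

variable {D : Matrix (Fin f) (Fin d) ℝ} {αl αu : ℝ}

lemma GFP.lower (hD : GFP D Set.univ αl αu) (v : Fin d → ℝ) :
    αl * l2 v ^ 2 ≤ l2 (D *ᵥ v) ^ 2 := by
  by_cases h : v = 0
  · simp [h]
  · exact (hD.bounds v trivial h).1

lemma GFP.upper (hD : GFP D Set.univ αl αu) (v : Fin d → ℝ) :
    l2 (D *ᵥ v) ^ 2 ≤ αu * l2 v ^ 2 := by
  by_cases h : v = 0
  · simp [h]
  · exact (hD.bounds v trivial h).2

lemma GFP.upper_pos (hD : GFP D Set.univ αl αu) : 0 < αu :=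
  hD.lower_pos.trans_le hD.lower_le_upper

lemma GFP.eq_zero (hD : GFP D Set.univ αl αu) {v : Fin d → ℝ} (h : D *ᵥ v = 0) : v = 0 := by
  have h1 := hD.lower v
  rw [h, l2_zero] at h1
  have h2 : l2 v ^ 2 ≤ 0 := by
    by_contra h3
    nlinarith [mul_pos hD.lower_pos (not_le.1 h3)]
  exact l2_eq_zero.1 (pow_eq_zero_iff two_ne_zero |>.1 (le_antisymm h2 (sq_nonneg _)))

lemma GFP.mul_eq_zero (hD : GFP D Set.univ αl αu) {H : Matrix (Fin d) (Fin N) ℝ}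
    (h : D * H = 0) : H = 0 := by
  refine Matrix.ext_col fun j => ?_
  have : D *ᵥ H.col j = 0 := by rw [← col_mul, h]; rfl
  rw [hD.eq_zero this]; rfl

lemma GFP.lower_frobNorm (hD : GFP D Set.univ αl αu) (H : Matrix (Fin d) (Fin N) ℝ) :
    αl * frobNorm H ^ 2 ≤ frobNorm (D * H) ^ 2 := by
  rw [frobNorm_sq_eq_sum_col, frobNorm_sq_eq_sum_col, Finset.mul_sum]
  exact Finset.sum_le_sum fun j _ => hD.lower _

lemma GFP.upper_frobNorm (hD : GFP D Set.univ αl αu) (H : Matrix (Fin d) (Fin N) ℝ) :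
    frobNorm (D * H) ≤ √αu * frobNorm H := by
  refine le_of_sq_le_sq ?_ (mul_nonneg (Real.sqrt_nonneg _) (frobNorm_nonneg _))
  rw [mul_pow, Real.sq_sqrt hD.upper_pos.le, frobNorm_sq_eq_sum_col, frobNorm_sq_eq_sum_col,
    Finset.mul_sum]
  exact Finset.sum_le_sum fun j _ => hD.upper _

end frame

/-! ### Inequalities defining `μ`, `β_U`, `γ_V`, `ξ_c`, and their degenerate values. -/

section parameters

variable {D : Matrix (Fin f) (Fin d) ℝ} {I : Finset (Fin N)}
  {U : Matrix (Fin f) (Fin r) ℝ} {V : Matrix (Fin N) (Fin r) ℝ}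

lemma mu_nonneg : 0 ≤ mu D I U V := by
  refine Real.sSup_nonneg ?_
  rintro _ ⟨Z, -, rfl⟩
  exact div_nonneg (frobNorm_nonneg _) (frobNorm_nonneg _)

lemma frobNorm_projL_le_mu (hU : Uᵀ * U = 1) (hV : Vᵀ * V = 1) {Z : Matrix (Fin f) (Fin N) ℝ}
    (hZ : Z ∈ dictSpace D I) : frobNorm (projL U V Z) ≤ mu D I U V * frobNorm Z := by
  by_cases h0 : Z = 0
  · simp [h0, projL]
  rw [← div_le_iff₀ (frobNorm_pos h0)]
  -- A real `sSup` is informative only for a bounded set; the ratios are at most 1 because `projL`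
  -- is an orthogonal projection.
  refine le_csSup ⟨1, ?_⟩ ⟨Z, ⟨hZ, h0⟩, rfl⟩
  rintro _ ⟨Y, -, rfl⟩
  exact div_le_one_of_le₀ (frobNorm_projL_le hU hV Y) (frobNorm_nonneg _)

/-- Such a `Z` is fixed by `projL`, so a nonzero one would give the ratio 1 in the supremum defining
`mu`. -/
lemma eq_zero_of_mem_dictSpace (hU : Uᵀ * U = 1) (hV : Vᵀ * V = 1) (hμ : mu D I U V < 1)
    {Z : Matrix (Fin f) (Fin N) ℝ} (hZ : Z ∈ dictSpace D I) (h : projMat U * Z = Z) : Z = 0 := by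
  by_contra h0
  have h1 := frobNorm_projL_le_mu hU hV hZ
  rw [projL_eq_self h] at h1
  nlinarith [frobNorm_pos h0]

lemma betaU_nonneg : 0 ≤ betaU D U := by
  refine Real.sSup_nonneg ?_
  rintro _ ⟨Z, -, rfl⟩
  exact div_nonneg (sq_nonneg _) (sq_nonneg _)

lemma l2_sq_le_betaU (hU : Uᵀ * U = 1) (u : Fin d → ℝ) :
    l2 ((1 - projMat U) *ᵥ (D *ᵥ u)) ^ 2 ≤ betaU D U * l2 (D *ᵥ u) ^ 2 := by
  by_cases h0 : D *ᵥ u = 0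
  · simp [h0]
  have hu : u ≠ 0 := by rintro rfl; simp at h0
  have hpos := l2_pos hu
  set c := (l2 u)⁻¹ with hc
  have hcpos : 0 < c := inv_pos.2 hpos
  have h1 : l2 ((1 - projMat U) *ᵥ (D *ᵥ (c • u))) ^ 2 / l2 (D *ᵥ (c • u)) ^ 2 ≤ betaU D U := by
    refine le_csSup ⟨1, ?_⟩ ⟨c • u, ?_, rfl⟩
    · rintro _ ⟨w, -, rfl⟩
      refine div_le_one_of_le₀ ?_ (sq_nonneg _)
      exact pow_le_pow_left₀ (l2_nonneg _) (l2_one_sub_projMat_le hU _) 2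
    · rw [Set.mem_ofPred_eq, l2_smul, abs_of_pos hcpos, hc, inv_mul_cancel₀ hpos.ne']
  simp only [Matrix.mulVec_smul, l2_smul, mul_pow] at h1
  rw [mul_div_mul_left _ _ (by positivity), div_le_iff₀ (pow_pos (l2_pos h0) 2)] at h1
  exact h1

lemma projMat_mul_dict_of_betaU_eq_zero (hU : Uᵀ * U = 1) (h : betaU D U = 0)
    (H : Matrix (Fin d) (Fin N) ℝ) : projMat U * (D * H) = D * H := by
  refine Matrix.ext_col fun j => ?_
  have h1 := l2_sq_le_betaU (D := D) hU (H.col j)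
  rw [h, zero_mul] at h1
  have h2 := l2_eq_zero.1 (pow_eq_zero_iff two_ne_zero |>.1 (le_antisymm h1 (sq_nonneg _)))
  rw [Matrix.sub_mulVec, Matrix.one_mulVec] at h2
  exact (sub_eq_zero.1 h2).symm

lemma l2_sq_le_gammaV (j : Fin N) : l2 ((projMat V).col j) ^ 2 ≤ gammaV V := by
  have h : l2 (projMat V *ᵥ Pi.single j 1) ^ 2 ≤ gammaV V :=
    le_ciSup (f := fun j : Fin N => l2 (projMat V *ᵥ Pi.single j 1) ^ 2)
      (Set.finite_range _).bddAbove j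
  rwa [Matrix.mulVec_single_one] at h

lemma gammaV_nonneg : 0 ≤ gammaV V := Real.iSup_nonneg fun _ => sq_nonneg _

/-- As `projMat V` is a symmetric idempotent, its entries are the inner products of its own columns.
-/
lemma abs_projMat_le_gammaV (hV : Vᵀ * V = 1) (i j : Fin N) : |projMat V i j| ≤ gammaV V := by
  have h1 : projMat V i j = (projMat V).col i ⬝ᵥ (projMat V).col j := by
    conv_lhs => rw [← projMat_mul_self hV, ← projMat_transpose V]
    rw [projMat_transpose V]
    conv_lhs => rw [Matrix.mul_apply]
    refine Finset.sum_congr rfl fun k _ => ?_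
    have : projMat V i k = projMat V k i := congrFun (congrFun (projMat_transpose V) k) i
    rw [this]; rfl
  have h2 := dotProduct_le_l2 ((projMat V).col i) ((projMat V).col j)
  have h3 := dotProduct_le_l2 (-(projMat V).col i) ((projMat V).col j)
  rw [neg_dotProduct, l2_neg] at h3
  have hi := l2_sq_le_gammaV (V := V) i
  have hj := l2_sq_le_gammaV (V := V) j
  have h4 : l2 ((projMat V).col i) * l2 ((projMat V).col j) ≤ gammaV V := by
    nlinarith [sq_nonneg (l2 ((projMat V).col i) - l2 ((projMat V).col j))]
  rw [h1, abs_le]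
  constructor <;> linarith

lemma projMat_eq_zero_of_gammaV_eq_zero (hV : Vᵀ * V = 1) (h : gammaV V = 0)
    (U : Matrix (Fin f) (Fin r) ℝ) :
    projMat U = 0 := by
  have h1 : projMat V = 0 := by
    ext i j
    have := abs_projMat_le_gammaV hV i j
    rw [h] at this
    exact abs_nonpos_iff.1 this
  have h2 : V = 0 := by rw [← projMat_mul hV, h1, Matrix.zero_mul]
  -- This forces `r = 0`.
  have h3 : (1 : Matrix (Fin r) (Fin r) ℝ) = 0 := by rw [← hV, h2, Matrix.mul_zero]
  rw [projMat, ← Matrix.mul_one U, h3]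
  simp

lemma xiC_nonneg : 0 ≤ xiC D U V := Real.iSup_nonneg fun _ => l2_nonneg _

lemma l2_col_le_xiC (j : Fin N) : l2 ((Dᵀ * (U * Vᵀ)).col j) ≤ xiC D U V := by
  rw [← Matrix.mul_assoc]
  exact le_ciSup (f := fun j : Fin N => l2 ((Dᵀ * U * Vᵀ).col j)) (Set.finite_range _).bddAbove j

lemma transpose_mul_eq_zero_of_xiC_eq_zero (hV : Vᵀ * V = 1) (h : xiC D U V = 0) :
    Dᵀ * U = 0 := by
  have h1 : Dᵀ * (U * Vᵀ) = 0 := by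
    refine Matrix.ext_col fun j => ?_
    have := l2_col_le_xiC (D := D) (U := U) (V := V) j
    rw [h] at this
    rw [l2_eq_zero.1 (le_antisymm this (l2_nonneg _))]
    rfl
  rw [← Matrix.mul_one U, ← hV, ← Matrix.mul_assoc U, ← Matrix.mul_assoc, h1, Matrix.zero_mul]

/-- Pythagoras leaves at least the fraction `1 - μ²` of the squared norm of `D * H` in the
complement. This is the coercivity behind the linear system for the certificate. -/
lemma frobNorm_projPerp_ge {αl αu : ℝ} (hD : GFP D Set.univ αl αu) (hU : Uᵀ * U = 1)
    (hV : Vᵀ * V = 1) (hμ : mu D I U V < 1) {H : Matrix (Fin d) (Fin N) ℝ} (hH : csupp H ⊆ I) :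
    √(αl * (1 - mu D I U V ^ 2)) * frobNorm H ≤ frobNorm (projPerp U V (D * H)) := by
  have hμ0 : 0 ≤ mu D I U V := mu_nonneg
  have h0 : 0 ≤ 1 - mu D I U V ^ 2 := by nlinarith
  refine le_of_sq_le_sq ?_ (frobNorm_nonneg _)
  rw [mul_pow, Real.sq_sqrt (mul_nonneg hD.lower_pos.le h0)]
  have h1 := frobNorm_projL_le_mu hU hV (show D * H ∈ dictSpace D I from ⟨H, hH, rfl⟩)
  have h2 := pow_le_pow_left₀ (frobNorm_nonneg _) h1 2
  have h3 := frobNorm_sq_eq_projL_add hU hV (D * H)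
  have h4 := mul_le_mul_of_nonneg_left (hD.lower_frobNorm H) h0
  rw [mul_pow] at h2
  nlinarith

end parameters

/-! ### Column masks and the linear system for the certificate. -/

/-- Right multiplication by this matrix sets the columns outside `I` to zero. -/
def colMask (I : Finset (Fin N)) : Matrix (Fin N) (Fin N) ℝ :=
  Matrix.diagonal fun j => if j ∈ I then 1 else 0

section colMask

variable {I : Finset (Fin N)}

lemma col_mul_colMask {m : ℕ} (X : Matrix (Fin m) (Fin N) ℝ) (j : Fin N) :
    (X * colMask I).col j = if j ∈ I then X.col j else 0 := by
  ext i
  by_cases h : j ∈ I <;> simp [colMask, Matrix.mul_diagonal, h]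

lemma csupp_mul_colMask (X : Matrix (Fin d) (Fin N) ℝ) : csupp (X * colMask I) ⊆ I := by
  intro j hj
  by_contra h
  simp [csupp, col_mul_colMask, h] at hj

lemma mul_colMask_of_csupp_subset {X : Matrix (Fin d) (Fin N) ℝ} (h : csupp X ⊆ I) :
    X * colMask I = X := by
  refine Matrix.ext_col fun j => ?_
  rw [col_mul_colMask]
  split_ifs with hj
  · rfl
  · exact (l2_col_eq_zero_of_notMem h hj).symm

lemma colMask_mul_self : colMask I * colMask I = colMask I := by
  rw [colMask, Matrix.diagonal_mul_diagonal]
  congr 1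
  ext j
  split_ifs <;> simp

lemma colMask_transpose : (colMask I)ᵀ = colMask I := Matrix.diagonal_transpose _

end colMask

section certificate

variable {D : Matrix (Fin f) (Fin d) ℝ} {I : Finset (Fin N)}
  {U : Matrix (Fin f) (Fin r) ℝ} {V : Matrix (Fin N) (Fin r) ℝ}

lemma frobNorm_projPerp_mul_sq (hU : Uᵀ * U = 1) (hV : Vᵀ * V = 1)
    {G : Matrix (Fin d) (Fin N) ℝ} (hG : csupp G ⊆ I) :
    frobNorm (projPerp U V (D * G)) ^ 2 =
      frobInner G (Dᵀ * projPerp U V (D * G) * colMask I) := by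
  rw [frobNorm_projPerp_sq hU hV, frobInner_mul_left]
  conv_lhs => rw [← mul_colMask_of_csupp_subset hG, frobInner_mul_right, colMask_transpose,
    mul_colMask_of_csupp_subset hG]

lemma exists_projPerp_mul_eq (hU : Uᵀ * U = 1) (hV : Vᵀ * V = 1) {κ : ℝ} (hκ : 0 < κ)
    (hle : ∀ H : Matrix (Fin d) (Fin N) ℝ, csupp H ⊆ I →
      κ * frobNorm H ≤ frobNorm (projPerp U V (D * H)))
    {B : Matrix (Fin d) (Fin N) ℝ} (hB : csupp B ⊆ I) :
    ∃ G : Matrix (Fin d) (Fin N) ℝ, csupp G ⊆ I ∧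
      Dᵀ * projPerp U V (D * G) * colMask I = B ∧
      κ * frobNorm (projPerp U V (D * G)) ≤ frobNorm B := by
  -- Adding the identity on the columns outside `I` turns the masked normal operator into an
  -- endomorphism of the whole space, so injectivity, which follows from coercivity, gives
  -- surjectivity.
  let T : Matrix (Fin d) (Fin N) ℝ →ₗ[ℝ] Matrix (Fin d) (Fin N) ℝ :=
    { toFun := fun H =>
        Dᵀ * projPerp U V (D * (H * colMask I)) * colMask I + H * (1 - colMask I)
      map_add' := fun X Y => by
        simp only [projPerp, Matrix.add_mul, Matrix.mul_add]
        abel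
      map_smul' := fun c X => by
        simp only [projPerp, Matrix.smul_mul, Matrix.mul_smul, smul_add, RingHom.id_apply] }
  have hmask : (1 - colMask I) * colMask I = 0 := by
    rw [Matrix.sub_mul, colMask_mul_self, Matrix.one_mul, sub_self]
  have hTmask (H) : T H * colMask I = Dᵀ * projPerp U V (D * (H * colMask I)) * colMask I := by
    change (Dᵀ * projPerp U V (D * (H * colMask I)) * colMask I + H * (1 - colMask I)) *
      colMask I = _
    rw [Matrix.add_mul, Matrix.mul_assoc _ (colMask I), colMask_mul_self, Matrix.mul_assoc H,
      hmask, Matrix.mul_zero, add_zero]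
  have hTsupp (H) (h : csupp (T H) ⊆ I) : H * colMask I = H := by
    have h1 := mul_colMask_of_csupp_subset h
    rw [hTmask] at h1
    have h2 : H * (1 - colMask I) = 0 := left_eq_add.1 h1
    rw [Matrix.mul_sub, Matrix.mul_one] at h2
    exact (sub_eq_zero.1 h2).symm
  have hinj : Function.Injective T := by
    rw [← LinearMap.ker_eq_bot, LinearMap.ker_eq_bot']
    intro H hH
    have h1 : H * colMask I = H := hTsupp H (by rw [hH]; intro j; simp [csupp, Matrix.col, funext_iff])
    have hsupp : csupp H ⊆ I := by rw [← h1]; exact csupp_mul_colMask _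
    have h2 := hTmask H
    rw [hH, Matrix.zero_mul, h1] at h2
    have h3 := frobNorm_projPerp_mul_sq (D := D) hU hV hsupp
    rw [← h2, frobInner_comm, frobInner_zero_left] at h3
    have h4 := hle H hsupp
    rw [pow_eq_zero_iff two_ne_zero |>.1 h3] at h4
    refine frobNorm_eq_zero.1 (le_antisymm ?_ (frobNorm_nonneg _))
    exact nonpos_of_mul_nonpos_right h4 hκ
  obtain ⟨G, hG⟩ := LinearMap.injective_iff_surjective.1 hinj B
  have h1 : G * colMask I = G := hTsupp G (by rwa [hG])
  have hsupp : csupp G ⊆ I := by rw [← h1]; exact csupp_mul_colMask _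
  have h2 : Dᵀ * projPerp U V (D * G) * colMask I = B := by
    have := hTmask G
    rwa [hG, h1, mul_colMask_of_csupp_subset hB, eq_comm] at this
  refine ⟨G, hsupp, h2, ?_⟩
  have h3 := frobNorm_projPerp_mul_sq (D := D) hU hV hsupp
  rw [h2] at h3
  have h4 := frobInner_le G B
  have h5 := hle G hsupp
  have hΓ := frobNorm_nonneg (projPerp U V (D * G))
  have hB0 := frobNorm_nonneg B
  set g := frobNorm (projPerp U V (D * G))
  rcases hΓ.eq_or_lt with h0 | h0
  · rw [← h0, mul_zero]; exact hB0
  -- With `g = frobNorm Γ`, `Γ = projPerp U V (D * G)`: `g² = ⟨G, B⟩ ≤ ‖G‖ ‖B‖` and `κ ‖G‖ ≤ g`.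
  · have h6 : κ * g * g ≤ frobNorm B * g := by
      nlinarith [mul_le_mul_of_nonneg_left h4 hκ.le, mul_le_mul_of_nonneg_right h5 hB0]
    exact le_of_mul_le_mul_right h6 h0

/-- Both factors `(1 - P_U) D` of the operator have norm at most `√(β_U α_u)`; pairing the image `y`
with itself exposes them. -/
lemma l2_transpose_mul_proj_le {αl αu : ℝ} (hD : GFP D Set.univ αl αu) (hU : Uᵀ * U = 1)
    (g : Fin d → ℝ) :
    l2 (Dᵀ *ᵥ ((1 - projMat U) *ᵥ (D *ᵥ g))) ≤ betaU D U * αu * l2 g := by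
  have hβ : 0 ≤ betaU D U := betaU_nonneg
  have hc : 0 ≤ betaU D U * αu := mul_nonneg hβ hD.upper_pos.le
  have hle (u : Fin d → ℝ) :
      l2 ((1 - projMat U) *ᵥ (D *ᵥ u)) ≤ √(betaU D U * αu) * l2 u := by
    refine le_of_sq_le_sq ?_ (mul_nonneg (Real.sqrt_nonneg _) (l2_nonneg _))
    rw [mul_pow, Real.sq_sqrt hc, mul_assoc]
    exact (l2_sq_le_betaU hU u).trans (mul_le_mul_of_nonneg_left (hD.upper u) hβ)
  set y := Dᵀ *ᵥ ((1 - projMat U) *ᵥ (D *ᵥ g)) with hy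
  refine l2_le_of_dotProduct_le ?_ (mul_nonneg hc (l2_nonneg _))
  have h1 : y ⬝ᵥ y = ((1 - projMat U) *ᵥ (D *ᵥ y)) ⬝ᵥ ((1 - projMat U) *ᵥ (D *ᵥ g)) := by
    rw [dotProduct_mulVec_left (1 - projMat U) (D *ᵥ y), one_sub_projMat_transpose,
      Matrix.mulVec_mulVec _ (1 - projMat U) (1 - projMat U), one_sub_projMat_mul_self hU,
      dotProduct_mulVec_left D y]
  rw [h1]
  calc _ ≤ _ := dotProduct_le_l2 _ _
    _ ≤ (√(betaU D U * αu) * l2 y) * (√(betaU D U * αu) * l2 g) :=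
      mul_le_mul (hle y) (hle g) (l2_nonneg _) (mul_nonneg (Real.sqrt_nonneg _) (l2_nonneg _))
    _ = (√(betaU D U * αu) * √(betaU D U * αu)) * l2 g * l2 y := by ring
    _ = _ := by rw [Real.mul_self_sqrt hc]

lemma sum_l2_col_le (G : Matrix (Fin d) (Fin N) ℝ) :
    ∑ i ∈ I, l2 (G.col i) ≤ √I.card * frobNorm G := by
  refine le_of_sq_le_sq ?_ (mul_nonneg (Real.sqrt_nonneg _) (frobNorm_nonneg _))
  rw [mul_pow, Real.sq_sqrt (Nat.cast_nonneg _), frobNorm_sq_eq_sum_col]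
  refine sq_sum_le_card_mul_sum_sq.trans (mul_le_mul_of_nonneg_left ?_ (Nat.cast_nonneg _))
  exact Finset.sum_le_univ_sum_of_nonneg fun i => sq_nonneg _

lemma l2_mulVec_projMat_col_le (hV : Vᵀ * V = 1) {G : Matrix (Fin d) (Fin N) ℝ}
    (hG : csupp G ⊆ I) (j : Fin N) :
    l2 (G *ᵥ (projMat V).col j) ≤ gammaV V * (√I.card * frobNorm G) := by
  have h1 : G *ᵥ (projMat V).col j = ∑ i ∈ I, projMat V i j • G.col i := by
    rw [Matrix.mulVec_eq_sum, eq_comm]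
    refine (Finset.sum_subset (Finset.subset_univ I) fun i _ hi => ?_).trans
      (Finset.sum_congr rfl fun i _ => ?_)
    · rw [l2_col_eq_zero_of_notMem hG hi, smul_zero]
    · ext; simp [Matrix.col, mul_comm]
  rw [h1]
  refine (l2_sum_le _ _).trans ?_
  refine le_trans ?_ (mul_le_mul_of_nonneg_left (sum_l2_col_le G) gammaV_nonneg)
  rw [Finset.mul_sum]
  refine Finset.sum_le_sum fun i _ => ?_
  rw [l2_smul]
  exact mul_le_mul_of_nonneg_right (abs_projMat_le_gammaV hV i j) (l2_nonneg _)

/-- Off `I` the column of `G` vanishes, so only `-G P_V e_j` survives of `G (1 - P_V) e_j`. This is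
where `γ_V` and the factor `√s` enter. -/
lemma l2_col_projPerp_le {αl αu : ℝ} (hD : GFP D Set.univ αl αu) (hU : Uᵀ * U = 1)
    (hV : Vᵀ * V = 1) {G : Matrix (Fin d) (Fin N) ℝ} (hG : csupp G ⊆ I) {j : Fin N} (hj : j ∉ I) :
    l2 ((Dᵀ * projPerp U V (D * G)).col j) ≤
      betaU D U * αu * (gammaV V * (√I.card * frobNorm G)) := by
  have hcol : (1 - projMat V).col j = Pi.single j 1 - (projMat V).col j := by
    rw [← Matrix.mulVec_single_one, Matrix.sub_mulVec, Matrix.one_mulVec, Matrix.mulVec_single_one]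
  have h1 : (Dᵀ * projPerp U V (D * G)).col j =
      Dᵀ *ᵥ ((1 - projMat U) *ᵥ (D *ᵥ (-(G *ᵥ (projMat V).col j)))) := by
    rw [projPerp, col_mul, Matrix.mul_assoc, Matrix.mul_assoc, col_mul, col_mul, col_mul, hcol,
      Matrix.mulVec_sub G, Matrix.mulVec_single_one, l2_col_eq_zero_of_notMem hG hj, zero_sub]
  rw [h1]
  refine (l2_transpose_mul_proj_le hD hU _).trans ?_
  rw [l2_neg]
  exact mul_le_mul_of_nonneg_left (l2_mulVec_projMat_col_le hV hG j)
    (mul_nonneg betaU_nonneg hD.upper_pos.le)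

end certificate

/-! ### Existence of a dual certificate. -/

/-- `U Vᵀ + Γ` is a dual certificate for the optimality of `(L, S)`. -/
structure IsDualCertificate (D : Matrix (Fin f) (Fin d) ℝ) (S : Matrix (Fin d) (Fin N) ℝ)
    (U : Matrix (Fin f) (Fin r) ℝ) (V : Matrix (Fin N) (Fin r) ℝ) (lam : ℝ)
    (Γ : Matrix (Fin f) (Fin N) ℝ) : Prop where
  left : Uᵀ * Γ = 0
  right : Γ * V = 0
  frobNorm_le : frobNorm Γ ≤ 1
  col_eq : ∀ j ∈ csupp S,
    (Dᵀ * (U * Vᵀ + Γ)).col j = (lam * (l2 (S.col j))⁻¹) • S.col j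
  l2_col_le : ∀ j, l2 ((Dᵀ * (U * Vᵀ + Γ)).col j) ≤ lam

section existence

variable {D : Matrix (Fin f) (Fin d) ℝ} {S : Matrix (Fin d) (Fin N) ℝ}
  {U : Matrix (Fin f) (Fin r) ℝ} {V : Matrix (Fin N) (Fin r) ℝ} {αl αu lam : ℝ}

/-- The matrix of the normalized columns. -/
def normalizeCols (S : Matrix (Fin d) (Fin N) ℝ) : Matrix (Fin d) (Fin N) ℝ :=
  Matrix.of fun i j => (l2 (S.col j))⁻¹ * S i j

lemma col_normalizeCols (S : Matrix (Fin d) (Fin N) ℝ) (j : Fin N) :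
    (normalizeCols S).col j = (l2 (S.col j))⁻¹ • S.col j := rfl

lemma col_ne_zero_of_mem_csupp {j : Fin N} (hj : j ∈ csupp S) : S.col j ≠ 0 := by
  simpa [csupp] using hj

lemma l2_inv_smul_self {k : ℕ} {x : Fin k → ℝ} (hx : x ≠ 0) : l2 ((l2 x)⁻¹ • x) = 1 := by
  rw [l2_smul, abs_of_pos (inv_pos.2 (l2_pos hx)), inv_mul_cancel₀ (l2_pos hx).ne']

lemma frobNorm_normalizeCols (S : Matrix (Fin d) (Fin N) ℝ) :
    frobNorm (normalizeCols S) = √(csupp S).card := by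
  rw [eq_comm, Real.sqrt_eq_iff_eq_sq (by positivity) (frobNorm_nonneg _),
    frobNorm_sq_eq_sum_col, ← Finset.sum_subset (Finset.subset_univ (csupp S))]
  · rw [Finset.sum_congr rfl fun j hj => by
      rw [col_normalizeCols, l2_inv_smul_self (col_ne_zero_of_mem_csupp hj)]]
    simp
  · intro j _ hj
    rw [col_normalizeCols, l2_col_eq_zero_of_notMem subset_rfl hj]
    simp

/-- Pair the masked matrix `B` with itself: `U * Vᵀ` sees only the `projL` part of `D * B`, which
costs a factor `μ`, and one factor `frobNorm B` cancels. -/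
lemma frobNorm_target_le (hD : GFP D Set.univ αl αu) (hU : Uᵀ * U = 1) (hV : Vᵀ * V = 1)
    (hlam : 0 ≤ lam) :
    frobNorm ((lam • normalizeCols S - Dᵀ * (U * Vᵀ)) * colMask (csupp S)) ≤
      lam * √(csupp S).card + √(r * αu) * mu D (csupp S) U V := by
  set μ := mu D (csupp S) U V
  have hμ : 0 ≤ μ := mu_nonneg
  set B := (lam • normalizeCols S - Dᵀ * (U * Vᵀ)) * colMask (csupp S) with hB
  have hsupp : csupp B ⊆ csupp S := csupp_mul_colMask _
  have h1 : frobNorm B ^ 2 = lam * frobInner B (normalizeCols S) - frobInner (U * Vᵀ) (D * B) := by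
    rw [frobNorm_sq]
    conv_lhs => rw [hB, frobInner_mul_right, colMask_transpose, ← hB,
      mul_colMask_of_csupp_subset hsupp, frobInner_comm, frobInner_sub_right]
    congr 1
    · simp [frobInner, Finset.mul_sum, mul_left_comm]
    · rw [frobInner_comm, frobInner_mul_left, Matrix.transpose_transpose]
  have h2 := frobInner_le B (normalizeCols S)
  rw [frobNorm_normalizeCols] at h2
  have h3 : -frobInner (U * Vᵀ) (D * B) ≤ √r * (μ * (√αu * frobNorm B)) := by
    rw [frobInner_mul_transpose_projL hU]
    refine (neg_frobInner_le _ _).trans ?_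
    rw [frobNorm_mul_transpose hU hV]
    refine mul_le_mul_of_nonneg_left ?_ (Real.sqrt_nonneg _)
    refine (frobNorm_projL_le_mu hU hV ⟨B, hsupp, rfl⟩).trans ?_
    exact mul_le_mul_of_nonneg_left (hD.upper_frobNorm B) hμ
  have h4 := mul_le_mul_of_nonneg_left h2 hlam
  rw [Real.sqrt_mul (Nat.cast_nonneg _)]
  rcases (frobNorm_nonneg B).eq_or_lt with h0 | h0
  · rw [← h0]; positivity
  · refine le_of_mul_le_mul_right ?_ h0
    nlinarith

lemma projPerp_left (hU : Uᵀ * U = 1) (Z : Matrix (Fin f) (Fin N) ℝ) :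
    Uᵀ * projPerp U V Z = 0 := by
  rw [projPerp, Matrix.mul_assoc, ← Matrix.mul_assoc, Matrix.mul_sub, transpose_mul_projMat hU]
  simp

lemma projPerp_right (hV : Vᵀ * V = 1) (Z : Matrix (Fin f) (Fin N) ℝ) :
    projPerp U V Z * V = 0 := by
  rw [projPerp, Matrix.mul_assoc, Matrix.sub_mul _ _ V, projMat_mul hV]
  simp

lemma exists_isDualCertificate (hD : GFP D Set.univ αl αu) (hU : Uᵀ * U = 1) (hV : Vᵀ * V = 1)
    (hS : S ≠ 0) (hlam : 0 ≤ lam) (hμ1 : mu D (csupp S) U V < 1)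
    (hmin : xiC D U V +
        √(r * (csupp S).card * αu) * mu D (csupp S) U V *
          constC αl αu (mu D (csupp S) U V) (gammaV V) (betaU D U) ≤
      lam * (1 - (csupp S).card * constC αl αu (mu D (csupp S) U V) (gammaV V) (betaU D U)))
    (hmax : lam ≤ lamMax αl αu (mu D (csupp S) U V) r (csupp S).card) :
    ∃ Γ, IsDualCertificate D S U V lam Γ ∧
      (0 < mu D (csupp S) U V ∨ lam < lamMax αl αu (mu D (csupp S) U V) r (csupp S).card →
        frobNorm Γ < 1) := by
  have htarget := frobNorm_target_le (S := S) hD hU hV hlam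
  have hle (H : Matrix (Fin d) (Fin N) ℝ) (hH : csupp H ⊆ csupp S) :=
    frobNorm_projPerp_ge hD hU hV hμ1 hH
  have hμ0 : 0 ≤ mu D (csupp S) U V := mu_nonneg
  have hβ0 : 0 ≤ betaU D U := betaU_nonneg
  have hγ0 : 0 ≤ gammaV V := gammaV_nonneg
  have hαl := hD.lower_pos
  have hαu := hD.upper_pos
  have hs : 0 < (csupp S).card := by
    rw [Finset.card_pos]
    by_contra h
    rw [Finset.not_nonempty_iff_eq_empty] at h
    refine hS (Matrix.ext_col fun j => ?_)
    rw [l2_col_eq_zero_of_notMem subset_rfl (show j ∉ csupp S by simp [h])]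
    rfl
  have hproj {j : Fin N} (hj : j ∉ csupp S) (G : Matrix (Fin d) (Fin N) ℝ)
      (hG : csupp G ⊆ csupp S) := l2_col_projPerp_le hD hU hV hG hj
  generalize mu D (csupp S) U V = μ at *
  generalize (csupp S).card = s at *
  set B := (lam • normalizeCols S - Dᵀ * (U * Vᵀ)) * colMask (csupp S) with hB
  have h1μ : 0 < 1 - μ := sub_pos.2 hμ1
  have h2μ : 0 < 1 - μ ^ 2 := by nlinarith
  set κ := √(αl * (1 - μ ^ 2)) with hκdef
  have hκ : 0 < κ := Real.sqrt_pos.2 (mul_pos hαl h2μ)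
  have hκsq : κ ^ 2 = αl * (1 - μ ^ 2) := Real.sq_sqrt (mul_pos hαl h2μ).le
  have hsqrt : √αl * (1 - μ) = √(αl * (1 - μ) ^ 2) := by
    rw [Real.sqrt_mul hαl.le, Real.sqrt_sq h1μ.le]
  have hκle : √αl * (1 - μ) ≤ κ := by
    rw [hsqrt]
    exact Real.sqrt_le_sqrt (mul_le_mul_of_nonneg_left (by nlinarith) hαl.le)
  -- For `μ > 0`, `(1 - μ)² < 1 - μ²` leaves slack, so `frobNorm Γ < 1` even at `lam = lamMax`.
  have hκlt (h : 0 < μ) : √αl * (1 - μ) < κ := by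
    rw [hsqrt]
    exact Real.sqrt_lt_sqrt (by positivity) (mul_lt_mul_of_pos_left (by nlinarith) hαl)
  have hsqs : 0 < √(s : ℝ) := Real.sqrt_pos.2 (Nat.cast_pos.2 hs)
  obtain ⟨G, hG, hGB, hΓ⟩ :=
    exists_projPerp_mul_eq hU hV hκ hle (B := B) (csupp_mul_colMask _)
  have hΓG := hle G hG
  set Γ := projPerp U V (D * G) with hΓdef
  have hmax' : lam * √s ≤ √αl * (1 - μ) - √(r * αu) * μ := by
    rwa [lamMax, le_div_iff₀ hsqs] at hmax
  have hcol (j) (hj : j ∈ csupp S) :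
      (Dᵀ * (U * Vᵀ + Γ)).col j = (lam * (l2 (S.col j))⁻¹) • S.col j := by
    have h := congrArg (fun X => X.col j) hGB
    simp only [hB, col_mul_colMask, hj, if_true] at h
    have h1 : (Dᵀ * (U * Vᵀ + Γ)).col j = (Dᵀ * (U * Vᵀ)).col j + (Dᵀ * Γ).col j := by
      rw [Matrix.mul_add]; rfl
    rw [h1, h]
    change (Dᵀ * (U * Vᵀ)).col j + (lam • (normalizeCols S).col j - (Dᵀ * (U * Vᵀ)).col j) = _
    rw [col_normalizeCols, smul_smul]
    abel
  refine ⟨Γ, ⟨projPerp_left hU _, projPerp_right hV _, ?_, hcol, ?_⟩, ?_⟩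
  · refine le_of_mul_le_mul_left ?_ hκ
    linarith
  · intro j
    by_cases hj : j ∈ csupp S
    · rw [hcol j hj, mul_smul, l2_smul, l2_inv_smul_self (col_ne_zero_of_mem_csupp hj),
        abs_of_nonneg hlam, mul_one]
    · have h1 : (Dᵀ * (U * Vᵀ + Γ)).col j = (Dᵀ * (U * Vᵀ)).col j + (Dᵀ * Γ).col j := by
        rw [Matrix.mul_add]; rfl
      have h2 : l2 ((Dᵀ * Γ).col j) ≤ betaU D U * αu * (gammaV V * (√s * frobNorm G)) :=
        hproj hj G hG
      rw [h1]
      refine (l2_add_le _ _).trans ((add_le_add (l2_col_le_xiC j) h2).trans ?_)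
      set C := constC αl αu μ (gammaV V) (betaU D U) with hC
      have hC0 : 0 ≤ C := by rw [hC, constC]; positivity
      -- `C_c` is exactly the constant for which the off-support bound becomes `C_c √s` times the
      -- bound on the target.
      have hCeq : betaU D U * αu * gammaV V = C * (αl * (1 - μ) ^ 2) := by
        rw [hC, constC]
        field_simp
      have hGle : αl * (1 - μ) ^ 2 * frobNorm G ≤ lam * √s + √(r * αu) * μ := by
        have e1 : αl * (1 - μ) ^ 2 ≤ κ ^ 2 := by
          rw [hκsq]
          exact mul_le_mul_of_nonneg_left (by nlinarith) hαl.le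
        have e2 := mul_le_mul_of_nonneg_right e1 (frobNorm_nonneg G)
        have e3 := mul_le_mul_of_nonneg_left hΓG hκ.le
        linarith
      have hsq : √(s : ℝ) * √s = s := Real.mul_self_sqrt (Nat.cast_nonneg _)
      have hrs : √(r * s * αu) = √s * √(r * αu) := by
        rw [mul_comm (r : ℝ) s, mul_assoc, Real.sqrt_mul (Nat.cast_nonneg _)]
      rw [hrs] at hmin
      have hfin := mul_le_mul_of_nonneg_left hGle (mul_nonneg hC0 hsqs.le)
      calc _ = xiC D U V + betaU D U * αu * gammaV V * (√s * frobNorm G) := by ring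
        _ = xiC D U V + C * √s * (αl * (1 - μ) ^ 2 * frobNorm G) := by rw [hCeq]; ring
        _ ≤ xiC D U V + C * √s * (lam * √s + √(r * αu) * μ) := by linarith
        _ = xiC D U V + √s * √(r * αu) * μ * C + lam * ((√s * √s) * C) := by ring
        _ ≤ lam := by rw [hsq]; linarith
  · intro h
    refine lt_of_mul_lt_mul_left ?_ hκ.le
    rcases h with h | h
    · have := hκlt h
      linarith
    · rw [lamMax, lt_div_iff₀ hsqs] at h
      linarith

end existence

/-! ### Optimality and uniqueness from the certificate. -/

section optimality

variable {M L : Matrix (Fin f) (Fin N) ℝ} {D : Matrix (Fin f) (Fin d) ℝ}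
  {S : Matrix (Fin d) (Fin N) ℝ} {U : Matrix (Fin f) (Fin r) ℝ} {σ : Fin r → ℝ}
  {V : Matrix (Fin N) (Fin r) ℝ} {αl αu lam : ℝ} {Γ : Matrix (Fin f) (Fin N) ℝ}

lemma l2_sq_certificate_mulVec (hU : Uᵀ * U = 1) (h : Uᵀ * Γ = 0) (v : Fin N → ℝ) :
    l2 ((U * Vᵀ + Γ) *ᵥ v) ^ 2 = l2 (Vᵀ *ᵥ v) ^ 2 + l2 (Γ *ᵥ v) ^ 2 := by
  have h1 : (U *ᵥ (Vᵀ *ᵥ v)) ⬝ᵥ (Γ *ᵥ v) = 0 := by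
    rw [dotProduct_mulVec_left, Matrix.mulVec_mulVec, h]
    simp
  have h2 : (U *ᵥ (Vᵀ *ᵥ v)) ⬝ᵥ (U *ᵥ (Vᵀ *ᵥ v)) = l2 (Vᵀ *ᵥ v) ^ 2 := by
    rw [dotProduct_mulVec_left, Matrix.mulVec_mulVec, hU, Matrix.one_mulVec, l2_sq]
  rw [Matrix.add_mulVec, ← Matrix.mulVec_mulVec, l2_sq, add_dotProduct, dotProduct_add,
    dotProduct_add, dotProduct_comm (Γ *ᵥ v) (U *ᵥ _), h1, h2, l2_sq (Γ *ᵥ v)]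
  ring

lemma l2_sq_eq_transpose_mulVec_add (hV : Vᵀ * V = 1) (v : Fin N → ℝ) :
    l2 v ^ 2 = l2 (Vᵀ *ᵥ v) ^ 2 + l2 ((1 - projMat V) *ᵥ v) ^ 2 := by
  rw [l2_sq_eq_projMat_add hV v]
  congr 1
  rw [projMat, ← Matrix.mulVec_mulVec, l2_sq, dotProduct_mulVec_left, Matrix.mulVec_mulVec, hV,
    Matrix.one_mulVec, l2_sq]

lemma l2_mulVec_le_of_mul_eq_zero (h : Γ * V = 0) (v : Fin N → ℝ) :
    l2 (Γ *ᵥ v) ≤ frobNorm Γ * l2 ((1 - projMat V) *ᵥ v) := by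
  have : Γ *ᵥ v = Γ *ᵥ ((1 - projMat V) *ᵥ v) := by
    rw [Matrix.mulVec_mulVec, Matrix.mul_sub, projMat, ← Matrix.mul_assoc, h]
    simp
  rw [this]
  exact l2_mulVec_le _ _

namespace IsDualCertificate

lemma l2_mulVec_le (hΓ : IsDualCertificate D S U V lam Γ) (hU : Uᵀ * U = 1) (hV : Vᵀ * V = 1)
    (v : Fin N → ℝ) : l2 ((U * Vᵀ + Γ) *ᵥ v) ≤ l2 v := by
  refine le_of_sq_le_sq ?_ (l2_nonneg _)
  rw [l2_sq_certificate_mulVec hU hΓ.left, l2_sq_eq_transpose_mulVec_add hV v]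
  refine add_le_add_right (pow_le_pow_left₀ (l2_nonneg _) ?_ 2) _
  exact (l2_mulVec_le_of_mul_eq_zero hΓ.right v).trans
    (mul_le_of_le_one_left (l2_nonneg _) hΓ.frobNorm_le)

/-- Norm preservation forces `‖Γ v‖ = ‖(1 - P_V) v‖`, and since `frobNorm Γ < 1` both vanish. Then
the certificate acts on `v` as `U * Vᵀ`. -/
lemma mulVec_mem_of_l2_eq (hΓ : IsDualCertificate D S U V lam Γ) (hU : Uᵀ * U = 1)
    (hV : Vᵀ * V = 1) (h1 : frobNorm Γ < 1) {v : Fin N → ℝ}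
    (hv : l2 ((U * Vᵀ + Γ) *ᵥ v) = l2 v) :
    projMat U *ᵥ ((U * Vᵀ + Γ) *ᵥ v) = (U * Vᵀ + Γ) *ᵥ v := by
  have h2 := l2_sq_certificate_mulVec (V := V) hU hΓ.left v
  rw [hv, l2_sq_eq_transpose_mulVec_add hV v, add_right_inj] at h2
  have h3 := l2_mulVec_le_of_mul_eq_zero hΓ.right v
  rw [← (sq_eq_sq₀ (l2_nonneg _) (l2_nonneg _)).1 h2] at h3
  have h4 : l2 ((1 - projMat V) *ᵥ v) = 0 := by
    nlinarith [l2_nonneg ((1 - projMat V) *ᵥ v)]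
  rw [h4, eq_comm, zero_pow two_ne_zero, pow_eq_zero_iff two_ne_zero, l2_eq_zero] at h2
  rw [Matrix.add_mulVec, h2, add_zero, Matrix.mulVec_mulVec, ← Matrix.mul_assoc, projMat_mul hU]

lemma frobInner_lowRank (hΓ : IsDualCertificate D S U V lam Γ) (hL : IsCompactSVD L U σ V) :
    frobInner (U * Vᵀ + Γ) L = nuclearNorm L := by
  have h : frobInner Γ L = 0 := by
    rw [hL.eq, Matrix.mul_assoc, frobInner_comm, frobInner_mul_left, hΓ.left, frobInner_comm,
      frobInner_zero_left]
  rw [frobInner_add_left, h, add_zero, hL.nuclearNorm_eq]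

lemma dotProduct_col_le (hΓ : IsDualCertificate D S U V lam Γ) (S' : Matrix (Fin d) (Fin N) ℝ)
    (j : Fin N) : (Dᵀ * (U * Vᵀ + Γ)).col j ⬝ᵥ S'.col j ≤ lam * l2 (S'.col j) :=
  (dotProduct_le_l2 _ _).trans (mul_le_mul_of_nonneg_right (hΓ.l2_col_le j) (l2_nonneg _))

lemma frobInner_sparse_le (hΓ : IsDualCertificate D S U V lam Γ)
    (S' : Matrix (Fin d) (Fin N) ℝ) :
    frobInner (U * Vᵀ + Γ) (D * S') ≤ lam * l12Norm S' := by
  rw [frobInner_comm, frobInner_mul_left, frobInner_comm, frobInner_eq_sum_col, l12Norm,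
    Finset.mul_sum]
  exact Finset.sum_le_sum fun j _ => hΓ.dotProduct_col_le S' j

lemma frobInner_sparse (hΓ : IsDualCertificate D S U V lam Γ) :
    frobInner (U * Vᵀ + Γ) (D * S) = lam * l12Norm S := by
  rw [frobInner_comm, frobInner_mul_left, frobInner_comm, frobInner_eq_sum_col, l12Norm,
    Finset.mul_sum]
  refine Finset.sum_congr rfl fun j _ => ?_
  by_cases hj : j ∈ csupp S
  · have h := l2_pos (col_ne_zero_of_mem_csupp hj)
    rw [hΓ.col_eq j hj, smul_dotProduct, ← l2_sq, smul_eq_mul]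
    field_simp
  · rw [l2_col_eq_zero_of_notMem subset_rfl hj]
    simp

lemma isSolution (hΓ : IsDualCertificate D S U V lam Γ) (hL : IsCompactSVD L U σ V) :
    IsSolution (L + D * S) D lam L S := by
  refine ⟨rfl, fun L' S' h => ?_⟩
  rw [← hΓ.frobInner_lowRank hL, ← hΓ.frobInner_sparse, ← frobInner_add_right, h,
    frobInner_add_right]
  exact add_le_add
    (frobInner_le_nuclearNorm (hΓ.l2_mulVec_le hL.left_orthonormal hL.right_orthonormal) L')
    (hΓ.frobInner_sparse_le S')

/-- A strict dual certificate constrains the difference between a solution and `(L, S)`. -/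
lemma projMat_mul_sub_and_l2_col (hΓ : IsDualCertificate D S U V lam Γ)
    (hL : IsCompactSVD L U σ V) (h1 : frobNorm Γ < 1) {L₀ : Matrix (Fin f) (Fin N) ℝ}
    {S₀ : Matrix (Fin d) (Fin N) ℝ} (hsol : IsSolution (L + D * S) D lam L₀ S₀) :
    projMat U * (D * (S₀ - S)) = D * (S₀ - S) ∧
      ∀ j ∉ csupp S, lam * l2 ((S₀ - S).col j) ≤ xiC D U V * l2 ((S₀ - S).col j) := by
  have hU := hL.left_orthonormal
  have hV := hL.right_orthonormal
  have hQ := hΓ.l2_mulVec_le hU hV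
  have hopt := hsol.le L S rfl
  rw [← hΓ.frobInner_lowRank hL, ← hΓ.frobInner_sparse, ← frobInner_add_right, hsol.feasible,
    frobInner_add_right] at hopt
  have ha := frobInner_le_nuclearNorm hQ L₀
  have hb := hΓ.frobInner_sparse_le S₀
  have hLeq : frobInner (U * Vᵀ + Γ) L₀ = nuclearNorm L₀ := by linarith
  have hSeq : frobInner (U * Vᵀ + Γ) (D * S₀) = lam * l12Norm S₀ := by linarith
  have hL₀ : projMat U * L₀ = L₀ := by
    refine Matrix.ext_col fun j => ?_
    have := mulVec_mem_of_frobInner_eq hQ hLeq (LinearMap.ker (1 - projMat U).mulVecLin)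
      (fun v hv => by
        rw [LinearMap.mem_ker, Matrix.mulVecLin_apply, Matrix.sub_mulVec,
          hΓ.mulVec_mem_of_l2_eq hU hV h1 hv, Matrix.one_mulVec, sub_self]) (Pi.single j 1)
    rw [Matrix.mulVec_single_one, LinearMap.mem_ker, Matrix.mulVecLin_apply, Matrix.sub_mulVec,
      Matrix.one_mulVec] at this
    exact (sub_eq_zero.1 this).symm
  have hPL : projMat U * L = L := by
    rw [hL.eq, ← Matrix.mul_assoc, ← Matrix.mul_assoc, projMat_mul hU]
  have hdiff : D * (S₀ - S) = L - L₀ := by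
    have := hsol.feasible
    rw [Matrix.mul_sub, sub_eq_sub_iff_add_eq_add, add_comm _ L₀, ← this]
  have hPD : projMat U * (D * (S₀ - S)) = D * (S₀ - S) := by
    rw [hdiff, Matrix.mul_sub, hPL, hL₀]
  refine ⟨hPD, fun j hj => ?_⟩
  have hcol : (S₀ - S).col j = S₀.col j := by
    change S₀.col j - S.col j = _
    rw [l2_col_eq_zero_of_notMem subset_rfl hj, sub_zero]
  rw [frobInner_comm, frobInner_mul_left, frobInner_comm, frobInner_eq_sum_col, l12Norm,
    Finset.mul_sum] at hSeq
  have hj1 := (Finset.sum_eq_sum_iff_of_le fun j _ => hΓ.dotProduct_col_le S₀ j).1 hSeq j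
    (Finset.mem_univ j)
  rw [← hcol] at hj1
  -- The columns of `D * (S₀ - S)` lie in the column space of `U`, to which `Γ` is orthogonal; only
  -- `Dᵀ U Vᵀ`, bounded by `ξ`, contributes.
  have hΓj : (Dᵀ * Γ).col j ⬝ᵥ (S₀ - S).col j = 0 := by
    rw [col_mul, dotProduct_mulVec_left, Matrix.transpose_transpose, ← col_mul, ← hPD, col_mul,
      ← projMat_transpose U, ← dotProduct_mulVec_left, ← col_mul, projMat, Matrix.mul_assoc,
      hΓ.left, Matrix.mul_zero]
    exact zero_dotProduct _
  have hsplit : (Dᵀ * (U * Vᵀ + Γ)).col j = (Dᵀ * (U * Vᵀ)).col j + (Dᵀ * Γ).col j := by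
    rw [Matrix.mul_add]; rfl
  rw [hsplit, add_dotProduct, hΓj, add_zero] at hj1
  rw [← hj1]
  exact (dotProduct_le_l2 _ _).trans
    (mul_le_mul_of_nonneg_right (l2_col_le_xiC j) (l2_nonneg _))

end IsDualCertificate

/-- At and above the threshold `λ_c^min`, a perturbation of `(L, S)` as allowed by a strict dual
certificate vanishes. -/
lemma eq_zero_of_projMat_mul_eq (hD : GFP D Set.univ αl αu) (hU : Uᵀ * U = 1) (hV : Vᵀ * V = 1)
    (hS : S ≠ 0) (hlam : 0 ≤ lam) (hμ1 : mu D (csupp S) U V < 1)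
    (hmin : xiC D U V +
        √(r * (csupp S).card * αu) * mu D (csupp S) U V *
          constC αl αu (mu D (csupp S) U V) (gammaV V) (betaU D U) ≤
      lam * (1 - (csupp S).card * constC αl αu (mu D (csupp S) U V) (gammaV V) (betaU D U)))
    {H : Matrix (Fin d) (Fin N) ℝ} (hH : projMat U * (D * H) = D * H)
    (hcol : ∀ j ∉ csupp S, lam * l2 (H.col j) ≤ xiC D U V * l2 (H.col j)) : H = 0 := by
  have hαl := hD.lower_pos
  have hαu := hD.upper_pos
  have hμ0 : 0 ≤ mu D (csupp S) U V := mu_nonneg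
  have hβ0 : 0 ≤ betaU D U := betaU_nonneg
  have hγ0 : 0 ≤ gammaV V := gammaV_nonneg
  have h1μ : 0 < 1 - mu D (csupp S) U V := sub_pos.2 hμ1
  refine hD.mul_eq_zero ?_
  rcases lt_or_ge (xiC D U V) lam with hlt | hge
  · refine eq_zero_of_mem_dictSpace hU hV hμ1 ⟨H, fun j hj => ?_, rfl⟩ hH
    by_contra hjS
    have hpos := l2_pos (col_ne_zero_of_mem_csupp hj)
    exact absurd (hcol j hjS) (not_le.2 (mul_lt_mul_of_pos_right hlt hpos))
  -- Here `lam ≤ ξ`, and `hmin` leaves room only for `lam * s * C = 0`, that is `C = 0` or `lam =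
  -- 0`.
  · have hs : 0 < ((csupp S).card : ℝ) := by
      rw [Nat.cast_pos, Finset.card_pos]
      by_contra h
      rw [Finset.not_nonempty_iff_eq_empty] at h
      refine hS (Matrix.ext_col fun j => ?_)
      rw [l2_col_eq_zero_of_notMem subset_rfl (show j ∉ csupp S by simp [h])]
      rfl
    set C := constC αl αu (mu D (csupp S) U V) (gammaV V) (betaU D U) with hC
    have hC0 : 0 ≤ C := by rw [hC, constC]; positivity
    rcases hC0.eq_or_lt with h0 | hCpos
    · have hγβ : gammaV V = 0 ∨ betaU D U = 0 := by
        have hne : αu / αl * (1 / (1 - mu D (csupp S) U V) ^ 2) ≠ 0 := by positivity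
        rw [hC, constC, eq_comm, mul_assoc, mul_eq_zero, or_iff_right hne, mul_eq_zero] at h0
        exact h0
      rcases hγβ with h | h
      · rw [← hH, projMat_eq_zero_of_gammaV_eq_zero hV h, Matrix.zero_mul]
      -- With `β_U = 0` all of `D * S` lies in the column space of `U`, which `μ < 1` forbids for `S
      -- ≠ 0`.
      · exfalso
        refine hS (hD.mul_eq_zero (eq_zero_of_mem_dictSpace hU hV hμ1 ⟨S, subset_rfl, rfl⟩ ?_))
        exact projMat_mul_dict_of_betaU_eq_zero hU h S
    · have hnn : 0 ≤ √(r * (csupp S).card * αu) * mu D (csupp S) U V * C := by positivity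
      have hlam0 : lam = 0 := by
        by_contra hne
        have := mul_pos (mul_pos (hlam.lt_of_ne' hne) hs) hCpos
        nlinarith
      rw [hlam0, zero_mul] at hmin
      have hξ : xiC D U V = 0 := le_antisymm (by linarith) xiC_nonneg
      have h1 : Uᵀ * D = 0 := by
        rw [← Matrix.transpose_transpose D, ← Matrix.transpose_mul,
          transpose_mul_eq_zero_of_xiC_eq_zero hV hξ, Matrix.transpose_zero]
      rw [← hH, projMat, Matrix.mul_assoc, ← Matrix.mul_assoc Uᵀ, h1, Matrix.zero_mul,
        Matrix.mul_zero]

lemma inOracleModel_self (hL : IsCompactSVD L U σ V) : InOracleModel D L S U L S where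
  proj_colSpace := by
    rw [hL.eq, ← Matrix.mul_assoc, ← Matrix.mul_assoc, projMat_mul hL.left_orthonormal]
  proj_csupp := by
    refine Matrix.ext_col fun j => ?_
    by_cases hj : j ∈ csupp S
    · ext i
      simp [projCols, hj]
    · rw [col_mul, l2_col_eq_zero_of_notMem subset_rfl hj, Matrix.mulVec_zero]
      ext i
      simp [projCols, hj]
  sum_eq := rfl

end optimality

end DRPCA

end

/-! ### The main theorem. -/

theorem theorem2 {f d N r s : ℕ}
    (M : Matrix (Fin f) (Fin N) ℝ) (D : Matrix (Fin f) (Fin d) ℝ)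
    (L : Matrix (Fin f) (Fin N) ℝ) (S : Matrix (Fin d) (Fin N) ℝ)
    (U : Matrix (Fin f) (Fin r) ℝ) (σ : Fin r → ℝ) (V : Matrix (Fin N) (Fin r) ℝ)
    (αl αu μ βU γV ξ C lam : ℝ)
    (hM : M = L + D * S)
    (hr : L.rank = r)
    (hSVD : DRPCA.IsCompactSVD L U σ V)
    (hS : S ≠ 0)
    (hs : (DRPCA.csupp S).card = s)
    (hD : DRPCA.GFP D Set.univ αl αu)
    (hμ : μ = DRPCA.mu D (DRPCA.csupp S) U V)
    (hβ : βU = DRPCA.betaU D U)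
    (hγ : γV = DRPCA.gammaV V)
    (hξ : ξ = DRPCA.xiC D U V)
    (hC : C = DRPCA.constC αl αu μ γV βU)
    (hμ1 : μ < 1)
    (hsmax : (s : ℝ) * (αu * γV * βU) ≤ αl * (1 - μ) ^ 2)
    (hden : 1 - (s : ℝ) * C ≠ 0)
    (hmin : DRPCA.lamMin αu μ ξ C r s ≤ lam)
    (hmax : lam ≤ DRPCA.lamMax αl αu μ r s) :
    (∃ (L₀ : Matrix (Fin f) (Fin N) ℝ) (S₀ : Matrix (Fin d) (Fin N) ℝ),
      DRPCA.IsSolution M D lam L₀ S₀ ∧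
      DRPCA.InOracleModel D L S U L₀ S₀ ∧
      DRPCA.colSpace L₀ = DRPCA.colSpace L ∧ DRPCA.csupp S₀ = DRPCA.csupp S) ∧
    ((0 < μ ∨ lam < DRPCA.lamMax αl αu μ r s) →
      ∀ (L₀ : Matrix (Fin f) (Fin N) ℝ) (S₀ : Matrix (Fin d) (Fin N) ℝ),
        DRPCA.IsSolution M D lam L₀ S₀ →
        DRPCA.InOracleModel D L S U L₀ S₀ ∧
        DRPCA.colSpace L₀ = DRPCA.colSpace L ∧ DRPCA.csupp S₀ = DRPCA.csupp S) := by
  subst hM hs hμ hβ hγ hξ hC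
  have hU := hSVD.left_orthonormal
  have hV := hSVD.right_orthonormal
  have hβ0 : 0 ≤ DRPCA.betaU D U := DRPCA.betaU_nonneg
  have hγ0 : 0 ≤ DRPCA.gammaV V := DRPCA.gammaV_nonneg
  have hμ0 : 0 ≤ DRPCA.mu D (DRPCA.csupp S) U V := DRPCA.mu_nonneg
  have hξ0 : 0 ≤ DRPCA.xiC D U V := DRPCA.xiC_nonneg
  have hαl := hD.lower_pos
  have hαu := hD.upper_pos
  have h1μ : 0 < 1 - DRPCA.mu D (DRPCA.csupp S) U V := sub_pos.2 hμ1
  have hC0 : 0 ≤ DRPCA.constC αl αu (DRPCA.mu D (DRPCA.csupp S) U V) (DRPCA.gammaV V)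
      (DRPCA.betaU D U) := by
    rw [DRPCA.constC]; positivity
  have hsC : 0 < 1 - ((DRPCA.csupp S).card : ℝ) * DRPCA.constC αl αu
      (DRPCA.mu D (DRPCA.csupp S) U V) (DRPCA.gammaV V) (DRPCA.betaU D U) := by
    -- `hsmax` says `s * C ≤ 1`, and `hden` excludes equality; the sign lets the lower bound on
    -- `lam` be cleared of its denominator.
    refine lt_of_le_of_ne ?_ hden.symm
    have h : ((DRPCA.csupp S).card : ℝ) * DRPCA.constC αl αu
        (DRPCA.mu D (DRPCA.csupp S) U V) (DRPCA.gammaV V) (DRPCA.betaU D U) =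
        ((DRPCA.csupp S).card * (αu * DRPCA.gammaV V * DRPCA.betaU D U)) /
          (αl * (1 - DRPCA.mu D (DRPCA.csupp S) U V) ^ 2) := by
      rw [DRPCA.constC]
      field_simp
    rw [h, sub_nonneg]
    exact div_le_one_of_le₀ hsmax (by positivity)
  have hlam : 0 ≤ lam := by
    refine le_trans (div_nonneg ?_ hsC.le) hmin
    positivity
  rw [DRPCA.lamMin, div_le_iff₀ hsC] at hmin
  obtain ⟨Γ, hΓ, hΓlt⟩ := DRPCA.exists_isDualCertificate hD hU hV hS hlam hμ1 hmin hmax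
  refine ⟨⟨L, S, hΓ.isSolution hSVD, DRPCA.inOracleModel_self hSVD, rfl, rfl⟩, ?_⟩
  intro hstrict L₀ S₀ hsol
  obtain ⟨hproj, hcol⟩ := hΓ.projMat_mul_sub_and_l2_col hSVD (hΓlt hstrict) hsol
  have hS₀ : S₀ = S :=
    sub_eq_zero.1 (DRPCA.eq_zero_of_projMat_mul_eq hD hU hV hS hlam hμ1 hmin hproj hcol)
  have hL₀ : L₀ = L := by
    have := hsol.feasible
    rw [hS₀] at this
    exact (add_right_cancel this).symm
  rw [hS₀, hL₀]
  exact ⟨DRPCA.inOracleModel_self hSVD, rfl, rfl⟩
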